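/- **Lemma (Purify then sketch).** For every real $\delta>0$ there are constants $C>0$ and $c_0>0$, depending only on $\delta$, such that the following holds. Let $n,d\ge 1$ be integers, let $A_1,\ldots,A_n\in\mathbb R^{d\times d}$ be symmetric matrices with $\operatorname{Tr}A_i=0$ for all $i$, and let $A=\sum_{i=1}^n A_i^2$. For each $g\in\{\pm1\}^n$ let $Y_g\in\mathbb R^{d\times d}$ be a density matrix, that is, a (symmetric) positive semidefinite matrix with $\operatorname{Tr}Y_g=1$. Then for every integer $r\ge 1$ there exist symmetric matrices $B_1,\ldots,B_n\in\mathbb R^{r\times r}$ such that $$\Big\|\sum_{i=1}^n B_i^2\Big\|\le C\Big(\|A\|+\frac{\min(\sqrt n,d)\,\operatorname{Tr}A}{r}\Big)$$ and such that for at least $\tfrac34\cdot 2^n$ of the $g\in\{\pm1\}^n$ there exist a vector $y_g\in\mathbb R^r$ with $\|y_g\|_2=1$ and a number $c_g\ge c_0$ with the property that, for at least $(1-\delta)n$ indices $i\in\{1,\ldots,n\}$, $$\big|\langle y_gy_g^\top,B_i\rangle-c_g\langle Y_g,A_i\rangle\big|\le\Big(C\Big(\frac{\|A\|}{nr}+\frac{\min(\sqrt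 n,d)\,\operatorname{Tr}A}{nr^2}\Big)\Big)^{1/2}.$$ Here $\|\cdot\|$ denotes the spectral (Euclidean operator) norm of a matrix and $\langle M,N\rangle=\operatorname{Tr}(MN)$. -/

import Mathlib

-- The norm `‖M‖` of a matrix is the spectral norm (the operator norm for Euclidean norms).
open scoped Matrix.Norms.L2Operator

/-- A density matrix: positive semidefinite (in particular symmetric) with trace one. -/
def IsDensityMatrix {d : ℕ} (Y : Matrix (Fin d) (Fin d) ℝ) : Prop :=
  Y.PosSemidef ∧ Y.trace = 1

/-- The inner product `⟨M, N⟩ = Tr (M N)` of matrices. -/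
noncomputable def matInner {d : ℕ} (M N : Matrix (Fin d) (Fin d) ℝ) : ℝ :=
  (M * N).trace

/-- The rank-one matrix `y yᵀ` of a vector `y`. -/
def rankOne {r : ℕ} (y : EuclideanSpace ℝ (Fin r)) : Matrix (Fin r) (Fin r) ℝ :=
  Matrix.of fun a b => y a * y b

/-- The quantity `‖A‖ + min(√n, d) Tr A / r`. -/
noncomputable def sketchBound (n r : ℕ) {d : ℕ} (A : Matrix (Fin d) (Fin d) ℝ) : ℝ :=
  ‖A‖ + min (Real.sqrt n) (d : ℝ) * A.trace / r

/-- The quantity `‖A‖ / (n r) + min(√n, d) Tr A / (n r²)`. -/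
noncomputable def sketchError (n r : ℕ) {d : ℕ} (A : Matrix (Fin d) (Fin d) ℝ) : ℝ :=
  ‖A‖ / (n * r) + min (Real.sqrt n) (d : ℝ) * A.trace / (n * (r : ℝ) ^ 2)

/-! Purification: write Y_g = W Wᵀ. Only the n + 1 numbers Tr Y_g and ⟨Y_g, A_i⟩ matter, so a
dimension count on symmetric matrices (`exists_fewer_columns`) replaces W by X with k = min(d,
⌊2√n⌋) columns. Vectorised, X is a unit vector x with xᵀ(A_i ⊗ 1_k)x = ⟨Y_g, A_i⟩. Passing to A_i ⊗
1_k does not increase the quadratic-form bound ‖A‖ and multiplies Tr A by k, which is the source of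
min(√n, d) Tr A.

Sketch: take independent r-row sign matrices U and V, using U on a set S of about half the rows and
V on the complement. B_i has off-diagonal blocks U A_i Vᵀ / r and its transpose, and y is the
normalisation of (Ux on S, Vx off S). Then yᵀB_i y is a bounded multiple of xᵀ P A_i Q x, where P =
UᵀU/|S| and Q = VᵀV/|Sᶜ| on the chosen rows are independent with mean the identity. Independence
reduces the error to two variance computations (`expect_sketch_error_le`). The norm of ∑ B_i² is
controlled by exponential moments of sign sums and a union bound over a net
(`expect_exists_net_le`).

Averaging the failures over signs and over g yields one pair (U, V) that serves three quarters of
the g (`exists_good_signs`). A Chebyshev count over i then discards at most δn indices. When r is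
bounded or A = 0, B = 0 already works. -/

open scoped BigOperators

/-- The sign `ω m` as a real number. -/
def sgn {M : Type*} (ω : M → ℤˣ) (m : M) : ℝ := ((ω m : ℤ) : ℝ)

/-- Flip the sign at `m`. -/
def flipSign {M : Type*} [DecidableEq M] (m : M) (ω : M → ℤˣ) : M → ℤˣ :=
  Function.update ω m (-ω m)

/-! ### Moments of Rademacher sums -/

section Signs

variable {M : Type*}

lemma sgn_mul_self (ω : M → ℤˣ) (m : M) : sgn ω m * sgn ω m = 1 := by
  unfold sgn
  rcases Int.units_eq_one_or (ω m) with h | h <;> simp [h]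

variable [DecidableEq M]

lemma sgn_flipSign_self (ω : M → ℤˣ) (m : M) : sgn (flipSign m ω) m = -sgn ω m := by
  simp [sgn, flipSign]

lemma sgn_flipSign_of_ne (ω : M → ℤˣ) {m k : M} (h : k ≠ m) :
    sgn (flipSign m ω) k = sgn ω k := by
  simp [sgn, flipSign, Function.update_of_ne h]

lemma flipSign_flipSign (m : M) (ω : M → ℤˣ) : flipSign m (flipSign m ω) = ω := by
  simp [flipSign]

lemma sum_sgn_flipSign {V : Type*} [AddCommGroup V] [Module ℝ V] {S : Finset M} {m : M}
    (hm : m ∉ S) (t : M → V) (ω : M → ℤˣ) :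
    ∑ k ∈ S, sgn (flipSign m ω) k • t k = ∑ k ∈ S, sgn ω k • t k :=
  Finset.sum_congr rfl fun k hk => by
    rw [sgn_flipSign_of_ne ω (ne_of_mem_of_not_mem hk hm)]

variable [Fintype M]

lemma expect_flipSign (f : (M → ℤˣ) → ℝ) (m : M) :
    𝔼 ω, f (flipSign m ω) = 𝔼 ω, f ω :=
  Fintype.expect_equiv (Function.Involutive.toPerm _ (flipSign_flipSign m)) _ _ fun _ => rfl

lemma expect_eq_half_flipSign (f : (M → ℤˣ) → ℝ) (m : M) :
    𝔼 ω, f ω = 𝔼 ω, (f ω + f (flipSign m ω)) / 2 := by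
  rw [← Finset.expect_div, Finset.expect_add_distrib, expect_flipSign]
  ring

/-- Pairing ω with its flip at m integrates out one sign; this is the inductive step of the moment
bounds below. -/
lemma expect_le_of_half_le {f g : (M → ℤˣ) → ℝ} (m : M)
    (h : ∀ ω, f ω + f (flipSign m ω) ≤ 2 * g ω) : 𝔼 ω, f ω ≤ 𝔼 ω, g ω := by
  rw [expect_eq_half_flipSign f m]
  exact Finset.expect_le_expect fun ω _ => by linarith [h ω]

lemma expect_eq_of_half_eq {f g : (M → ℤˣ) → ℝ} (m : M)
    (h : ∀ ω, f ω + f (flipSign m ω) = 2 * g ω) : 𝔼 ω, f ω = 𝔼 ω, g ω := by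
  rw [expect_eq_half_flipSign f m]
  exact Finset.expect_congr rfl fun ω _ => by linarith [h ω]

/-- Averaging out one sign produces a cosh, bounded by a Gaussian exponential; Cauchy–Schwarz
absorbs it by shrinking v to v - ‖t m‖². The weight R, insensitive to the signs in S, stands in for
an independent factor. -/
lemma expect_mul_exp_norm_sq_le {V : Type*} [NormedAddCommGroup V] [InnerProductSpace ℝ V]
    (t : M → V) (S : Finset M) : ∀ (v : ℝ), ∑ m ∈ S, ‖t m‖ ^ 2 < v →
    ∀ R : (M → ℤˣ) → ℝ, (∀ ω, 0 ≤ R ω) → (∀ m ∈ S, ∀ ω, R (flipSign m ω) = R ω) →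
    𝔼 ω, R ω * Real.exp (‖∑ m ∈ S, sgn ω m • t m‖ ^ 2 / (2 * v)) ≤
      Real.exp ((∑ m ∈ S, ‖t m‖ ^ 2) / (2 * (v - ∑ m ∈ S, ‖t m‖ ^ 2))) * 𝔼 ω, R ω := by
  induction S using Finset.induction_on with
  | empty => intro v hv R hR _; simp
  | insert m S hm ih =>
    intro v hv R hR hinv
    rw [Finset.sum_insert hm] at hv ⊢
    set s := ∑ m ∈ S, ‖t m‖ ^ 2 with hs
    have hs0 : 0 ≤ s := Finset.sum_nonneg fun _ _ => sq_nonneg _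
    set τ := ‖t m‖ ^ 2 with hτ
    have hτ0 : 0 ≤ τ := sq_nonneg _
    have hv0 : 0 < v := by linarith
    have hvτ : 0 < v - τ := by linarith
    have h1 : 𝔼 ω, R ω * Real.exp (‖∑ k ∈ insert m S, sgn ω k • t k‖ ^ 2 / (2 * v)) ≤
        𝔼 ω, Real.exp (τ / (2 * v)) *
          (R ω * Real.exp (‖∑ k ∈ S, sgn ω k • t k‖ ^ 2 / (2 * (v - τ)))) := by
      apply expect_le_of_half_le m
      intro ω
      rw [Finset.sum_insert hm, Finset.sum_insert hm, sum_sgn_flipSign hm, sgn_flipSign_self,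
        hinv m (Finset.mem_insert_self _ _)]
      set c := ∑ k ∈ S, sgn ω k • t k
      set p := inner ℝ (t m) c with hp
      have hsg := sgn_mul_self ω m
      have hn : ‖sgn ω m • t m‖ ^ 2 = τ := by
        rw [norm_smul, mul_pow, Real.norm_eq_abs, sq_abs, pow_two, hsg, one_mul]
      have hn' : ‖-sgn ω m • t m‖ ^ 2 = τ := by rw [neg_smul, norm_neg, hn]
      have e1 : ‖sgn ω m • t m + c‖ ^ 2 = τ + ‖c‖ ^ 2 + 2 * (sgn ω m * p) := by
        rw [norm_add_sq_real, hn, inner_smul_left]; simp [hp]; ring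
      have e2 : ‖-sgn ω m • t m + c‖ ^ 2 = τ + ‖c‖ ^ 2 - 2 * (sgn ω m * p) := by
        rw [norm_add_sq_real, hn', inner_smul_left]; simp [hp]; ring
      have hcs : p ^ 2 ≤ τ * ‖c‖ ^ 2 := by
        rw [hτ, ← mul_pow]
        exact sq_le_sq' (by linarith [(abs_le.1 (abs_real_inner_le_norm (t m) c)).1])
          (abs_le.1 (abs_real_inner_le_norm (t m) c)).2
      have hcosh := Real.cosh_le_exp_half_sq (sgn ω m * p / v)
      rw [Real.cosh_eq] at hcosh
      have key : Real.exp ((τ + ‖c‖ ^ 2 + 2 * (sgn ω m * p)) / (2 * v)) +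
          Real.exp ((τ + ‖c‖ ^ 2 - 2 * (sgn ω m * p)) / (2 * v)) ≤
          2 * (Real.exp (τ / (2 * v)) * Real.exp (‖c‖ ^ 2 / (2 * (v - τ)))) := by
        have a1 : (τ + ‖c‖ ^ 2 + 2 * (sgn ω m * p)) / (2 * v) =
            (τ + ‖c‖ ^ 2) / (2 * v) + sgn ω m * p / v := by field_simp
        have a2 : (τ + ‖c‖ ^ 2 - 2 * (sgn ω m * p)) / (2 * v) =
            (τ + ‖c‖ ^ 2) / (2 * v) + -(sgn ω m * p / v) := by field_simp; ring
        rw [a1, a2, Real.exp_add, Real.exp_add, ← mul_add, ← Real.exp_add]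
        have : Real.exp ((τ + ‖c‖ ^ 2) / (2 * v)) * Real.exp ((sgn ω m * p / v) ^ 2 / 2) ≤
            Real.exp (τ / (2 * v) + ‖c‖ ^ 2 / (2 * (v - τ))) := by
          rw [← Real.exp_add]
          apply Real.exp_le_exp.2
          have b1 : (sgn ω m * p / v) ^ 2 / 2 ≤ τ * ‖c‖ ^ 2 / (2 * v ^ 2) := by
            rw [div_pow, mul_pow, pow_two (sgn ω m), hsg, one_mul, div_div, mul_comm (v ^ 2) 2]
            gcongr
          -- This is 1/v + τ/v² ≤ 1/(v - τ), the start of a geometric series.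
          have b2 : ‖c‖ ^ 2 / (2 * v) + τ * ‖c‖ ^ 2 / (2 * v ^ 2) ≤
              ‖c‖ ^ 2 / (2 * (v - τ)) := by
            rw [div_add_div _ _ (by positivity) (by positivity),
              div_le_div_iff₀ (by positivity) (by positivity)]
            have : 0 ≤ ‖c‖ ^ 2 * τ ^ 2 * v := by positivity
            nlinarith
          have b3 : (τ + ‖c‖ ^ 2) / (2 * v) = τ / (2 * v) + ‖c‖ ^ 2 / (2 * v) := add_div _ _ _
          linarith
        have e0 := Real.exp_pos ((τ + ‖c‖ ^ 2) / (2 * v))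
        nlinarith
      rw [e1, e2]
      nlinarith [hR ω]
    have h2 := ih (v - τ) (by linarith) R hR fun k hk => hinv k (Finset.mem_insert_of_mem hk)
    rw [← Finset.mul_expect] at h1
    have hE : 0 ≤ 𝔼 ω, R ω := Finset.expect_nonneg fun ω _ => hR ω
    refine h1.trans ((mul_le_mul_of_nonneg_left h2 (Real.exp_pos _).le).trans ?_)
    rw [← mul_assoc, ← Real.exp_add]
    refine mul_le_mul_of_nonneg_right (Real.exp_le_exp.2 ?_) hE
    have b1 : τ / (2 * v) ≤ τ / (2 * (v - (τ + s))) := by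
      apply div_le_div_of_nonneg_left hτ0 <;> linarith
    have b2 : v - τ - s = v - (τ + s) := by ring
    rw [b2, add_div]
    linarith

/-- Distinct blocks involve disjoint sets of signs, so they are peeled off one at a time, the
remaining ones serving as the weight R. The bound v / 2 makes s / (2(v - s)) at most s / v. -/
lemma expect_exp_sum_blocks_le {V : Type*} [NormedAddCommGroup V] [InnerProductSpace ℝ V]
    {β : Type*} [DecidableEq β] (blk : M → β) (t : M → V) {v : ℝ} (hv : 0 < v)
    (h : ∀ b, ∑ m with blk m = b, ‖t m‖ ^ 2 ≤ v / 2) (T : Finset β) :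
    𝔼 ω, Real.exp ((∑ b ∈ T, ‖∑ m with blk m = b, sgn ω m • t m‖ ^ 2) / (2 * v)) ≤
      Real.exp ((∑ b ∈ T, ∑ m with blk m = b, ‖t m‖ ^ 2) / v) := by
  induction T using Finset.induction_on with
  | empty => simp
  | insert b T hb ih =>
    set s := ∑ m with blk m = b, ‖t m‖ ^ 2 with hs
    have hs0 : 0 ≤ s := Finset.sum_nonneg fun _ _ => sq_nonneg _
    have hb' := h b
    rw [← hs] at hb'
    have h1 := expect_mul_exp_norm_sq_le t ({m | blk m = b} : Finset M) v (by linarith)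
      (fun ω => Real.exp ((∑ b ∈ T, ‖∑ m with blk m = b, sgn ω m • t m‖ ^ 2) / (2 * v)))
      (fun _ => (Real.exp_pos _).le) (by
        intro m hm ω
        have hm : blk m = b := by simpa using hm
        congr 2
        refine Finset.sum_congr rfl fun b' hb' => ?_
        rw [sum_sgn_flipSign]
        simp only [Finset.mem_filter, Finset.mem_univ, true_and]
        rintro rfl
        exact hb (hm ▸ hb'))
    rw [← hs] at h1
    rw [Finset.sum_insert hb, add_div, Real.exp_add]
    simp_rw [Finset.sum_insert hb, add_div, Real.exp_add]
    simp_rw [mul_comm (Real.exp (‖∑ m with blk m = b, sgn _ m • t m‖ ^ 2 / (2 * v)))]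
    refine h1.trans (mul_le_mul (Real.exp_le_exp.2 ?_) ih
      (Finset.expect_nonneg fun _ _ => (Real.exp_pos _).le) (Real.exp_pos _).le)
    rw [← hs]
    apply div_le_div_of_nonneg_left hs0 hv
    linarith

lemma expect_mul_sum_mul_sum (x y : M → ℝ) (S : Finset M) (R : (M → ℤˣ) → ℝ)
    (hinv : ∀ m ∈ S, ∀ ω, R (flipSign m ω) = R ω) :
    𝔼 ω, R ω * ((∑ m ∈ S, sgn ω m • x m) * (∑ m ∈ S, sgn ω m • y m)) =
      (∑ m ∈ S, x m * y m) * 𝔼 ω, R ω := by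
  induction S using Finset.induction_on with
  | empty => simp
  | insert m S hm ih =>
    rw [Finset.sum_insert hm, add_mul, ← ih fun k hk => hinv k (Finset.mem_insert_of_mem hk),
      Finset.mul_expect, ← Finset.expect_add_distrib]
    apply expect_eq_of_half_eq m
    intro ω
    simp only [Finset.sum_insert hm, sum_sgn_flipSign hm, sgn_flipSign_self,
      hinv m (Finset.mem_insert_self _ _)]
    simp only [smul_eq_mul]
    linear_combination 2 * R ω * x m * y m * sgn_mul_self ω m

lemma expect_sum_mul_sum (x y : M → ℝ) (S : Finset M) :
    𝔼 ω, (∑ m ∈ S, sgn ω m • x m) * (∑ m ∈ S, sgn ω m • y m) = ∑ m ∈ S, x m * y m := by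
  simpa using expect_mul_sum_mul_sum x y S (fun _ => 1) fun _ _ _ => rfl

lemma expect_sq_mul_sq_le (x y : M → ℝ) (S : Finset M) :
    𝔼 ω, (∑ m ∈ S, sgn ω m • x m) ^ 2 * (∑ m ∈ S, sgn ω m • y m) ^ 2 ≤
      3 * (∑ m ∈ S, x m ^ 2) * ∑ m ∈ S, y m ^ 2 := by
  induction S using Finset.induction_on with
  | empty => simp
  | insert m S hm ih =>
    have h1 : 𝔼 ω, (∑ k ∈ insert m S, sgn ω k • x k) ^ 2 *
          (∑ k ∈ insert m S, sgn ω k • y k) ^ 2 =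
        𝔼 ω, ((∑ k ∈ S, sgn ω k • x k) ^ 2 * (∑ k ∈ S, sgn ω k • y k) ^ 2 +
          (y m ^ 2 * ((∑ k ∈ S, sgn ω k • x k) * (∑ k ∈ S, sgn ω k • x k)) +
          (x m ^ 2 * ((∑ k ∈ S, sgn ω k • y k) * (∑ k ∈ S, sgn ω k • y k)) +
          (4 * x m * y m * ((∑ k ∈ S, sgn ω k • x k) * (∑ k ∈ S, sgn ω k • y k)) +
          x m ^ 2 * y m ^ 2)))) := by
      apply expect_eq_of_half_eq m
      intro ω
      simp only [Finset.sum_insert hm, sum_sgn_flipSign hm, sgn_flipSign_self]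
      simp only [smul_eq_mul]
      have h := sgn_mul_self ω m
      set e := sgn ω m
      set a := ∑ k ∈ S, sgn ω k * x k
      set b := ∑ k ∈ S, sgn ω k * y k
      linear_combination (2 * y m ^ 2 * a ^ 2 + 2 * x m ^ 2 * b ^ 2 + 8 * x m * y m * a * b +
        2 * x m ^ 2 * y m ^ 2 * (e ^ 2 + 1)) * h
    rw [h1]
    simp only [Finset.expect_add_distrib, ← Finset.mul_expect, expect_sum_mul_sum,
      Fintype.expect_const, Finset.sum_insert hm]
    have hcs := Finset.sum_mul_sq_le_sq_mul_sq S x y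
    simp only [← pow_two]
    set X := ∑ k ∈ S, x k ^ 2
    set Y := ∑ k ∈ S, y k ^ 2
    set p := ∑ k ∈ S, x k * y k
    have hX : 0 ≤ X := Finset.sum_nonneg fun _ _ => sq_nonneg _
    have hY : 0 ≤ Y := Finset.sum_nonneg fun _ _ => sq_nonneg _
    -- Cauchy–Schwarz and AM–GM: the cross term costs twice the two mixed terms already present,
    -- hence the constant 3.
    have h4 : 4 * x m * y m * p ≤ 2 * (X * y m ^ 2 + Y * x m ^ 2) := by
      have hle : (2 * (x m * y m * p)) ^ 2 ≤ (X * y m ^ 2 + Y * x m ^ 2) ^ 2 := by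
        have := mul_le_mul_of_nonneg_left hcs (by positivity : 0 ≤ 4 * x m ^ 2 * y m ^ 2)
        nlinarith [sq_nonneg (X * y m ^ 2 - Y * x m ^ 2)]
      have := (abs_le.1 (abs_le_of_sq_le_sq hle (by positivity))).2
      linarith
    have : 0 ≤ x m ^ 2 * y m ^ 2 := by positivity
    nlinarith

end Signs

/-! ### Random sign matrices -/

section SignMatrix

variable {ρ ι : Type*}

/-- The matrix whose entries are the signs `ω`. -/
def signMatrix (ω : ρ × ι → ℤˣ) : Matrix ρ ι ℝ := Matrix.of fun j a => sgn ω (j, a)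

variable [Fintype ρ] [Fintype ι]

lemma sum_filter_fst [DecidableEq ρ] {V : Type*} [AddCommMonoid V] (f : ρ × ι → V) (j : ρ) :
    ∑ m with m.1 = j, f m = ∑ a, f (j, a) := by
  rw [Finset.sum_filter, Fintype.sum_prod_type, Fintype.sum_eq_single j]
  · simp
  · intro k hk
    simp [hk]

lemma sum_filter_snd [DecidableEq ι] {V : Type*} [AddCommMonoid V] (f : ρ × ι → V) (a : ι) :
    ∑ m with m.2 = a, f m = ∑ j, f (j, a) := by
  rw [Finset.sum_filter, Fintype.sum_prod_type_right, Fintype.sum_eq_single a]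
  · simp
  · intro k hk
    simp [hk]

lemma signMatrix_dotProduct [DecidableEq ρ] (ω : ρ × ι → ℤˣ) (j : ρ) (x : ι → ℝ) :
    signMatrix ω j ⬝ᵥ x = ∑ m with m.1 = j, sgn ω m • x m.2 := by
  rw [sum_filter_fst (fun m : ρ × ι => sgn ω m • x m.2)]
  rfl

variable [DecidableEq ρ] [DecidableEq ι]

/-- The columns of the sign matrix are the independent blocks. With ‖u‖² ≤ 4 each block has variance
at most 4α, so v = 8α is admissible. -/
lemma expect_exp_sum_vecMul_le (u : ρ → ℝ) (hu : u ⬝ᵥ u ≤ 4) (lam : ι → ℝ) {α : ℝ} (hα : 0 < α)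
    (h0 : ∀ a, 0 ≤ lam a) (h1 : ∀ a, lam a ≤ α) :
    𝔼 ω : ρ × ι → ℤˣ, Real.exp ((∑ a, lam a * (Matrix.vecMul u (signMatrix ω)) a ^ 2) / (16 * α)) ≤
      Real.exp ((∑ a, lam a) / (2 * α)) := by
  have hu0 : 0 ≤ u ⬝ᵥ u := by
    rw [dotProduct]; exact Finset.sum_nonneg fun _ _ => mul_self_nonneg _
  have hs : ∀ a, ∑ m : ρ × ι with m.2 = a, ‖Real.sqrt (lam m.2) * u m.1‖ ^ 2 =
      lam a * (u ⬝ᵥ u) := by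
    intro a
    rw [sum_filter_snd (fun m : ρ × ι => ‖Real.sqrt (lam m.2) * u m.1‖ ^ 2), dotProduct,
      Finset.mul_sum]
    refine Finset.sum_congr rfl fun j _ => ?_
    rw [Real.norm_eq_abs, sq_abs, mul_pow, Real.sq_sqrt (h0 a), pow_two]
  have h := expect_exp_sum_blocks_le (M := ρ × ι) (fun m => m.2)
    (fun m => Real.sqrt (lam m.2) * u m.1) (v := 8 * α) (by linarith) (by
      intro a
      rw [hs]
      nlinarith [h0 a, h1 a]) Finset.univ
  simp_rw [hs] at h
  have e : ∀ (ω : ρ × ι → ℤˣ) (a : ι),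
      ‖∑ m : ρ × ι with m.2 = a, sgn ω m • (Real.sqrt (lam m.2) * u m.1)‖ ^ 2 =
        lam a * (Matrix.vecMul u (signMatrix ω)) a ^ 2 := by
    intro ω a
    rw [sum_filter_snd (fun m : ρ × ι => sgn ω m • (Real.sqrt (lam m.2) * u m.1)),
      Real.norm_eq_abs, sq_abs]
    have : ∑ j, sgn ω (j, a) • (Real.sqrt (lam a) * u j) =
        Real.sqrt (lam a) * (Matrix.vecMul u (signMatrix ω)) a := by
      rw [Matrix.vecMul, dotProduct, Finset.mul_sum]
      refine Finset.sum_congr rfl fun j _ => ?_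
      simp only [signMatrix, Matrix.of_apply, smul_eq_mul]
      ring
    rw [this, mul_pow, Real.sq_sqrt (h0 a)]
  simp_rw [e] at h
  rw [show 2 * (8 * α) = 16 * α by ring] at h
  refine h.trans (Real.exp_le_exp.2 ?_)
  rw [← Finset.sum_mul, div_le_div_iff₀ (by positivity) (by positivity)]
  have : 0 ≤ ∑ a, lam a := Finset.sum_nonneg fun a _ => h0 a
  nlinarith [mul_nonneg this hα.le]

/-- The rows are the independent blocks here: row j contributes a sign sum in ℝⁿ collecting its
products with all the w i, of variance at most θ. -/
lemma expect_exp_sum_mulVec_le {n : ℕ} (w : Fin n → ι → ℝ) {θ : ℝ} (hθ : 0 < θ)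
    (hw : ∑ i, w i ⬝ᵥ w i ≤ θ) :
    𝔼 ω : ρ × ι → ℤˣ, Real.exp ((∑ i, (Matrix.mulVec (signMatrix ω) (w i)) ⬝ᵥ
        (Matrix.mulVec (signMatrix ω) (w i))) / (4 * θ)) ≤
      Real.exp ((Fintype.card ρ : ℝ) / 2) := by
  set t : ρ × ι → EuclideanSpace ℝ (Fin n) := fun m => WithLp.toLp 2 fun i => w i m.2 with ht
  have hs : ∀ j, ∑ m : ρ × ι with m.1 = j, ‖t m‖ ^ 2 = ∑ i, w i ⬝ᵥ w i := by
    intro j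
    rw [sum_filter_fst (fun m : ρ × ι => ‖t m‖ ^ 2)]
    simp only [ht, EuclideanSpace.norm_sq_eq, Real.norm_eq_abs, sq_abs, dotProduct]
    rw [Finset.sum_comm]
    simp only [pow_two]
  have h := expect_exp_sum_blocks_le (M := ρ × ι) (fun m => m.1) t (v := 2 * θ) (by linarith) (by
      intro j
      rw [hs]
      linarith) Finset.univ
  simp_rw [hs] at h
  have e : ∀ (ω : ρ × ι → ℤˣ), ∑ j, ‖∑ m : ρ × ι with m.1 = j, sgn ω m • t m‖ ^ 2 =
      ∑ i, (Matrix.mulVec (signMatrix ω) (w i)) ⬝ᵥ (Matrix.mulVec (signMatrix ω) (w i)) := by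
    intro ω
    simp only [dotProduct]
    rw [Finset.sum_comm]
    refine Finset.sum_congr rfl fun j _ => ?_
    rw [sum_filter_fst (fun m : ρ × ι => sgn ω m • t m), EuclideanSpace.norm_sq_eq]
    refine Finset.sum_congr rfl fun i _ => ?_
    rw [Real.norm_eq_abs, sq_abs, pow_two]
    simp [ht, Matrix.mulVec, dotProduct, signMatrix]
  simp_rw [e] at h
  rw [show 2 * (2 * θ) = 4 * θ by ring] at h
  refine h.trans (Real.exp_le_exp.2 ?_)
  rw [Finset.sum_const, Finset.card_univ, nsmul_eq_mul, div_le_div_iff₀ (by positivity) (by positivity)]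
  have : (0 : ℝ) ≤ Fintype.card ρ := by positivity
  nlinarith [mul_le_mul_of_nonneg_left hw this]

lemma signMatrix_flipSign_dotProduct (ω : ρ × ι → ℤˣ) {j : ρ} {m : ρ × ι} (h : m.1 ≠ j)
    (x : ι → ℝ) : signMatrix (flipSign m ω) j ⬝ᵥ x = signMatrix ω j ⬝ᵥ x := by
  rw [signMatrix_dotProduct, signMatrix_dotProduct, sum_sgn_flipSign]
  simpa using h

/-- The summands are centred and depend on different rows, so variances add; each is at most the
fourth-moment bound. -/
lemma expect_sq_sum_rows_le (x v : ι → ℝ) (S : Finset ρ) :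
    𝔼 ω : ρ × ι → ℤˣ,
      (∑ j ∈ S, ((signMatrix ω j ⬝ᵥ x) * (signMatrix ω j ⬝ᵥ v) - x ⬝ᵥ v)) ^ 2 ≤
      S.card * (3 * (x ⬝ᵥ x) * (v ⬝ᵥ v)) := by
  induction S using Finset.induction_on with
  | empty => simp
  | insert j S hj ih =>
    simp_rw [Finset.sum_insert hj]
    set R : (ρ × ι → ℤˣ) → ℝ := fun ω =>
      ∑ j ∈ S, ((signMatrix ω j ⬝ᵥ x) * (signMatrix ω j ⬝ᵥ v) - x ⬝ᵥ v) with hR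
    have hinv : ∀ m ∈ ({m | m.1 = j} : Finset (ρ × ι)), ∀ ω, R (flipSign m ω) = R ω := by
      intro m hm ω
      have hm : m.1 = j := by simpa using hm
      refine Finset.sum_congr rfl fun k hk => ?_
      have hne : m.1 ≠ k := by
        rw [hm]
        rintro rfl
        exact hj hk
      rw [signMatrix_flipSign_dotProduct ω hne, signMatrix_flipSign_dotProduct ω hne]
    have hxy : ∀ y z : ι → ℝ, ∑ m : ρ × ι with m.1 = j, y m.2 * z m.2 = y ⬝ᵥ z := fun y z => by
      rw [sum_filter_fst (fun m : ρ × ι => y m.2 * z m.2)]; rfl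
    have hx2 : ∀ y : ι → ℝ, ∑ m : ρ × ι with m.1 = j, y m.2 ^ 2 = y ⬝ᵥ y := fun y => by
      rw [← hxy]
      simp only [pow_two]
    have c1 := expect_mul_sum_mul_sum (fun m : ρ × ι => x m.2) (fun m => v m.2) _ R hinv
    have c2 := expect_sq_mul_sq_le (fun m : ρ × ι => x m.2) (fun m => v m.2)
      ({m | m.1 = j} : Finset (ρ × ι))
    have c3 := expect_sum_mul_sum (fun m : ρ × ι => x m.2) (fun m => v m.2)
      ({m | m.1 = j} : Finset (ρ × ι))
    simp only [← signMatrix_dotProduct] at c1 c2 c3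
    rw [hxy] at c1 c3
    rw [hx2, hx2] at c2
    have e : 𝔼 ω : ρ × ι → ℤˣ,
        ((signMatrix ω j ⬝ᵥ x) * (signMatrix ω j ⬝ᵥ v) - x ⬝ᵥ v + R ω) ^ 2 =
        𝔼 ω : ρ × ι → ℤˣ, ((signMatrix ω j ⬝ᵥ x) ^ 2 * (signMatrix ω j ⬝ᵥ v) ^ 2 +
          ((-(2 * (x ⬝ᵥ v))) * ((signMatrix ω j ⬝ᵥ x) * (signMatrix ω j ⬝ᵥ v)) +
          ((x ⬝ᵥ v) ^ 2 + (2 * (R ω * ((signMatrix ω j ⬝ᵥ x) * (signMatrix ω j ⬝ᵥ v))) +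
          ((-(2 * (x ⬝ᵥ v))) * R ω + R ω ^ 2))))) :=
      Finset.expect_congr rfl fun ω _ => by ring
    rw [e]
    simp only [Finset.expect_add_distrib, ← Finset.mul_expect, Fintype.expect_const, c1, c3]
    rw [Finset.card_insert_of_notMem hj]
    push_cast
    nlinarith [sq_nonneg (x ⬝ᵥ v)]

end SignMatrix

/-! ### A lattice net of the unit ball -/

section Net

lemma sum_Icc_half_pow_natAbs (m : ℕ) :
    ∑ k ∈ Finset.Icc (-(m : ℤ)) m, (1 / 2 : ℝ) ^ k.natAbs = 3 - 2 * (1 / 2) ^ m := by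
  induction m with
  | zero => norm_num
  | succ m ih =>
    have h : Finset.Icc (-((m + 1 : ℕ) : ℤ)) ((m + 1 : ℕ) : ℤ) =
        insert (-((m : ℤ) + 1)) (insert ((m : ℤ) + 1) (Finset.Icc (-(m : ℤ)) m)) := by
      ext k
      simp only [Finset.mem_Icc, Finset.mem_insert]
      push_cast
      omega
    rw [h, Finset.sum_insert, Finset.sum_insert, ih]
    · rw [Int.natAbs_neg, show ((m : ℤ) + 1).natAbs = m + 1 by omega, pow_succ]
      ring
    · simp only [Finset.mem_Icc]; omega
    · simp only [Finset.mem_insert, Finset.mem_Icc]; omega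

variable {ρ : Type*} [Fintype ρ] [DecidableEq ρ]

/-- For integers |k| ≤ k², so every counted point has weight ∏ 2^(-|k j|) at least 8^(-r), while the
total weight of the box factors and is at most 4^r. -/
lemma card_filter_sum_sq_le (r m : ℕ) (hr : Fintype.card ρ = r) :
    (((Fintype.piFinset fun _ : ρ => Finset.Icc (-(m : ℤ)) m).filter
      fun k => ∑ j, k j ^ 2 ≤ (3 * r : ℤ)).card : ℝ) ≤ 32 ^ r := by
  have h1 : ∀ k ∈ (Fintype.piFinset fun _ : ρ => Finset.Icc (-(m : ℤ)) m).filter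
      (fun k => ∑ j, k j ^ 2 ≤ (3 * r : ℤ)),
      (1 : ℝ) ≤ 2 ^ (3 * r) * ∏ j, (1 / 2 : ℝ) ^ (k j).natAbs := by
    intro k hk
    rw [Finset.mem_filter] at hk
    have hle : ∑ j, (k j).natAbs ≤ 3 * r := by
      have : (((∑ j, (k j).natAbs : ℕ)) : ℤ) ≤ ∑ j, k j ^ 2 := by
        push_cast
        refine Finset.sum_le_sum fun j _ => ?_
        rw [← sq_abs]
        rcases (abs_nonneg (k j)).eq_or_lt with h | h
        · rw [← h]; norm_num
        · nlinarith
      have := this.trans hk.2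
      exact_mod_cast this
    rw [Finset.prod_pow_eq_pow_sum, one_div, inv_pow, ← div_eq_mul_inv, le_div_iff₀ (by positivity),
      one_mul]
    exact pow_le_pow_right₀ (by norm_num) hle
  calc (((Fintype.piFinset fun _ : ρ => Finset.Icc (-(m : ℤ)) m).filter
      fun k => ∑ j, k j ^ 2 ≤ (3 * r : ℤ)).card : ℝ)
      = ∑ k ∈ (Fintype.piFinset fun _ : ρ => Finset.Icc (-(m : ℤ)) m).filter
        (fun k => ∑ j, k j ^ 2 ≤ (3 * r : ℤ)), (1 : ℝ) := by simp
    _ ≤ ∑ k ∈ (Fintype.piFinset fun _ : ρ => Finset.Icc (-(m : ℤ)) m).filter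
        (fun k => ∑ j, k j ^ 2 ≤ (3 * r : ℤ)), 2 ^ (3 * r) * ∏ j, (1 / 2 : ℝ) ^ (k j).natAbs :=
        Finset.sum_le_sum h1
    _ ≤ ∑ k ∈ (Fintype.piFinset fun _ : ρ => Finset.Icc (-(m : ℤ)) m),
        2 ^ (3 * r) * ∏ j, (1 / 2 : ℝ) ^ (k j).natAbs :=
        Finset.sum_le_sum_of_subset_of_nonneg (Finset.filter_subset _ _)
          fun _ _ _ => by positivity
    _ = 2 ^ (3 * r) * (3 - 2 * (1 / 2) ^ m) ^ r := by
        rw [← Finset.mul_sum, ← Finset.prod_univ_sum (fun _ : ρ => Finset.Icc (-(m : ℤ)) m)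
          (fun _ k => (1 / 2 : ℝ) ^ k.natAbs)]
        simp only [sum_Icc_half_pow_natAbs, Finset.prod_const, Finset.card_univ, hr]
    _ ≤ 2 ^ (3 * r) * 4 ^ r := by
        have h0 : (0 : ℝ) < (1 / 2) ^ m := by positivity
        have h1 : (1 / 2 : ℝ) ^ m ≤ 1 := pow_le_one₀ (by norm_num) (by norm_num)
        gcongr <;> linarith
    _ = 32 ^ r := by rw [pow_mul, ← mul_pow]; norm_num

/-- Round to the lattice r^(-1/2) ℤ^r: each coordinate moves by at most r^(-1/2) / 2, so the squared
distance is at most 1/4. -/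
lemma exists_net (r : ℕ) (hr : Fintype.card ρ = r) (hr0 : 0 < r) :
    ∃ N : Finset (ρ → ℝ), (N.card : ℝ) ≤ 32 ^ r ∧ (∀ u ∈ N, u ⬝ᵥ u ≤ 4) ∧
      ∀ v : ρ → ℝ, v ⬝ᵥ v ≤ 1 → ∃ u ∈ N, (v - u) ⬝ᵥ (v - u) ≤ 1 / 4 := by
  classical
  have hrr : (0 : ℝ) < r := by exact_mod_cast hr0
  set s := Real.sqrt r with hs
  have hs0 : 0 < s := Real.sqrt_pos.2 hrr
  have hs2 : s * s = r := Real.mul_self_sqrt hrr.le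
  -- The box only ensures finiteness; the condition ∑ k_j² ≤ 3r already forces |k_j| ≤ 3r.
  refine ⟨((Fintype.piFinset fun _ : ρ => Finset.Icc (-((3 * r : ℕ) : ℤ)) (3 * r : ℕ)).filter
      fun k => ∑ j, k j ^ 2 ≤ (3 * r : ℤ)).image fun k j => (k j : ℝ) / s, ?_, ?_, ?_⟩
  · exact le_trans (by exact_mod_cast Finset.card_image_le) (card_filter_sum_sq_le r (3 * r) hr)
  · intro u hu
    obtain ⟨k, hk, rfl⟩ := Finset.mem_image.1 hu
    have hk2 := (Finset.mem_filter.1 hk).2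
    have hk3 : ∑ j, (k j : ℝ) ^ 2 ≤ 3 * r := by exact_mod_cast hk2
    have : (fun j => (k j : ℝ) / s) ⬝ᵥ (fun j => (k j : ℝ) / s) = (∑ j, (k j : ℝ) ^ 2) / r := by
      rw [dotProduct, Finset.sum_div]
      refine Finset.sum_congr rfl fun j _ => ?_
      rw [← hs2]; field_simp
    rw [this, div_le_iff₀ hrr]
    linarith
  · intro v hv
    have he : ∀ j, (s * v j - round (s * v j)) ^ 2 ≤ 1 / 4 := fun j => by
      have := abs_sub_round (s * v j)
      rw [← sq_abs]
      nlinarith [abs_nonneg (s * v j - round (s * v j))]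
    have hk : ∑ j, (round (s * v j)) ^ 2 ≤ 3 * (r : ℤ) := by
      have : ∑ j, ((round (s * v j) : ℤ) : ℝ) ^ 2 ≤ 3 * r := by
        calc ∑ j, ((round (s * v j) : ℤ) : ℝ) ^ 2
            ≤ ∑ j, (3 / 2 * r * (v j * v j) + 3 / 4) := by
              refine Finset.sum_le_sum fun j _ => ?_
              rw [← hs2]
              -- With rounding error e, (a - e)² ≤ (3/2)a² + 3e², since the difference is (a + 2e)²
              -- / 2; and 3e² ≤ 3/4.
              nlinarith [he j, sq_nonneg (s * v j - 2 * (s * v j - round (s * v j))),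
                sq_nonneg (s * v j + 2 * (s * v j - round (s * v j)))]
          _ = 3 / 2 * r * (v ⬝ᵥ v) + 3 / 4 * r := by
              rw [Finset.sum_add_distrib, ← Finset.mul_sum, Finset.sum_const, Finset.card_univ, hr,
                nsmul_eq_mul, dotProduct]
              ring
          _ ≤ 3 * r := by nlinarith
      exact_mod_cast this
    refine ⟨fun j => ((round (s * v j) : ℤ) : ℝ) / s, Finset.mem_image.2
      ⟨fun j => round (s * v j), Finset.mem_filter.2 ⟨Fintype.mem_piFinset.2 fun j => ?_, hk⟩,
        rfl⟩, ?_⟩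
    · have h1 : (round (s * v j)) ^ 2 ≤ 3 * (r : ℤ) :=
        (Finset.single_le_sum (f := fun j => (round (s * v j)) ^ 2)
          (fun _ _ => sq_nonneg _) (Finset.mem_univ j)).trans hk
      rw [Finset.mem_Icc]
      push_cast
      constructor <;> nlinarith
    · calc _ = (∑ j, (s * v j - round (s * v j)) ^ 2) / r := by
            rw [dotProduct, Finset.sum_div]
            refine Finset.sum_congr rfl fun j _ => ?_
            rw [← hs2]
            simp only [Pi.sub_apply]
            field_simp
        _ ≤ (∑ _j : ρ, (1 / 4 : ℝ)) / r := by
            gcongr with j _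
            exact he j
        _ = 1 / 4 := by
            rw [Finset.sum_const, Finset.card_univ, hr, nsmul_eq_mul]
            field_simp

lemma opNorm_le_of_net {E F : Type*} [NormedAddCommGroup E] [NormedSpace ℝ E]
    [NormedAddCommGroup F] [NormedSpace ℝ F] (T : E →L[ℝ] F) (N : Set E) {c : ℝ} (hc : 0 ≤ c)
    (hN : ∀ u ∈ N, ‖T u‖ ≤ c) (hnet : ∀ v, ‖v‖ ≤ 1 → ∃ u ∈ N, ‖v - u‖ ≤ 1 / 2) :
    ‖T‖ ≤ 2 * c := by
  have h : ‖T‖ ≤ c + ‖T‖ * (1 / 2) := by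
    refine T.opNorm_le_of_unit_norm (by positivity) fun v hv => ?_
    obtain ⟨u, hu, huv⟩ := hnet v hv.le
    calc ‖T v‖ = ‖T u + T (v - u)‖ := by rw [map_sub]; congr 1; abel
      _ ≤ ‖T u‖ + ‖T (v - u)‖ := norm_add_le _ _
      _ ≤ c + ‖T‖ * (1 / 2) := add_le_add (hN u hu) (T.le_opNorm_of_le huv)
  linarith

/-- Stacking the `T i` vertically turns the sum of squares into one squared norm, so the net
argument for a single operator applies. -/
lemma sum_mulVec_le_of_net {n : ℕ} {κ : Type*} [Fintype κ] [DecidableEq κ]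
    (T : Fin n → Matrix κ ρ ℝ) (N : Finset (ρ → ℝ)) {c : ℝ}
    (hc : 0 ≤ c) (hN : ∀ u ∈ N, ∑ i, Matrix.mulVec (T i) u ⬝ᵥ Matrix.mulVec (T i) u ≤ c)
    (hnet : ∀ v : ρ → ℝ, v ⬝ᵥ v ≤ 1 → ∃ u ∈ N, (v - u) ⬝ᵥ (v - u) ≤ 1 / 4) (v : ρ → ℝ) :
    ∑ i, Matrix.mulVec (T i) v ⬝ᵥ Matrix.mulVec (T i) v ≤ 4 * c * (v ⬝ᵥ v) := by
  set S : Matrix (Fin n × κ) ρ ℝ := Matrix.of fun p j => T p.1 p.2 j with hS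
  set L : EuclideanSpace ℝ ρ →L[ℝ] EuclideanSpace ℝ (Fin n × κ) :=
    LinearMap.toContinuousLinearMap (Matrix.toEuclideanLin S) with hL
  have hn : ∀ v : EuclideanSpace ℝ ρ, ‖v‖ ^ 2 = v.ofLp ⬝ᵥ v.ofLp := fun v => by
    rw [EuclideanSpace.norm_sq_eq, dotProduct]
    refine Finset.sum_congr rfl fun j _ => ?_
    rw [Real.norm_eq_abs, sq_abs, pow_two]
  have hLn : ∀ v : EuclideanSpace ℝ ρ,
      ‖L v‖ ^ 2 = ∑ i, Matrix.mulVec (T i) v.ofLp ⬝ᵥ Matrix.mulVec (T i) v.ofLp := fun v => by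
    rw [EuclideanSpace.norm_sq_eq, Fintype.sum_prod_type]
    refine Finset.sum_congr rfl fun i _ => ?_
    rw [dotProduct]
    refine Finset.sum_congr rfl fun j _ => ?_
    rw [Real.norm_eq_abs, sq_abs, pow_two]
    rfl
  have h := opNorm_le_of_net L {u | u.ofLp ∈ N} (Real.sqrt_nonneg c)
    (fun u hu => Real.le_sqrt_of_sq_le (by rw [hLn]; exact hN _ hu)) (fun v hv => by
      obtain ⟨u, hu, huv⟩ := hnet v.ofLp (by rw [← hn]; nlinarith [norm_nonneg v])
      refine ⟨WithLp.toLp 2 u, hu, ?_⟩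
      have := hn (v - WithLp.toLp 2 u)
      have h2 : ‖v - WithLp.toLp 2 u‖ ^ 2 ≤ (1 / 2) ^ 2 := by
        rw [this]
        norm_num
        simpa using huv
      exact (sq_le_sq₀ (norm_nonneg _) (by norm_num)).1 h2)
  have h3 := L.le_of_opNorm_le h (WithLp.toLp 2 v)
  have h4 := hLn (WithLp.toLp 2 v)
  have h5 := hn (WithLp.toLp 2 v)
  simp only at h4 h5
  rw [← h4, ← h5]
  calc ‖L (WithLp.toLp 2 v)‖ ^ 2 ≤ (2 * Real.sqrt c * ‖WithLp.toLp 2 v‖) ^ 2 := by gcongr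
    _ = 4 * c * ‖WithLp.toLp 2 v‖ ^ 2 := by
      rw [mul_pow, mul_pow, Real.sq_sqrt hc]; ring

end Net

/-! ### Norm and error of the random sketch -/

section Sketch

open scoped Matrix

variable {ι : Type*} [Fintype ι] {n r : ℕ}

lemma dotProduct_self_nonneg' {κ : Type*} [Fintype κ] (v : κ → ℝ) : 0 ≤ v ⬝ᵥ v :=
  Finset.sum_nonneg fun _ _ => mul_self_nonneg _

lemma exp_neg_eight_mul_le (hr : 0 < r) : (32 : ℝ) ^ r * Real.exp (-(8 * r)) ≤ 1 / 64 := by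
  have h1 : (2048 : ℝ) ≤ Real.exp 8 := by
    have h := Real.exp_one_gt_d9
    have : Real.exp 8 = Real.exp 1 ^ 8 := by rw [← Real.exp_nat_mul]; norm_num
    rw [this]
    calc (2048 : ℝ) ≤ 2.7 ^ 8 := by norm_num
      _ ≤ Real.exp 1 ^ 8 := by gcongr; linarith
  have h2 : Real.exp (-(8 * r : ℝ)) = (1 / Real.exp 8) ^ r := by
    rw [one_div, ← Real.exp_neg, ← Real.exp_nat_mul]
    congr 1
    ring
  rw [h2, ← mul_pow]
  have h3 : 32 * (1 / Real.exp 8) ≤ 1 / 64 := by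
    rw [mul_one_div, div_le_div_iff₀ (by positivity) (by norm_num)]
    linarith
  calc (32 * (1 / Real.exp 8)) ^ r ≤ (1 / 64) ^ r := by gcongr
    _ ≤ 1 / 64 := by
      simpa using pow_le_pow_of_le_one (by norm_num : (0 : ℝ) ≤ 1 / 64) (by norm_num) hr

open Classical in
-- Two tail bounds for each net point u: first on ∑ ‖A_i z‖² for z = uᵀU, at level θ, then, with U
-- fixed and that event excluded, on ∑ ‖V A_i z‖² at level 34rθ. Each fails with probability at most
-- e^(-8r), which beats the 32^r net points because e^8 ≥ 2048.
lemma expect_exists_net_le [DecidableEq ι] (A : Fin n → Matrix ι ι ℝ) (lam : ι → ℝ) {α : ℝ}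
    (hα : 0 < α)
    (h0 : ∀ a, 0 ≤ lam a) (h1 : ∀ a, lam a ≤ α)
    (hquad : ∀ z, ∑ i, (A i *ᵥ z) ⬝ᵥ (A i *ᵥ z) = ∑ a, lam a * z a ^ 2)
    (hr : 0 < r) (N : Finset (Fin r → ℝ)) (hcard : (N.card : ℝ) ≤ 32 ^ r)
    (hN : ∀ u ∈ N, u ⬝ᵥ u ≤ 4) :
    𝔼 ω : Fin r × ι → ℤˣ, 𝔼 η : Fin r × ι → ℤˣ,
      (if ∃ u ∈ N, 34 * r * (128 * α * r + 8 * ∑ a, lam a) <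
        ∑ i, (signMatrix η *ᵥ (A i *ᵥ (u ᵥ* signMatrix ω))) ⬝ᵥ
          (signMatrix η *ᵥ (A i *ᵥ (u ᵥ* signMatrix ω))) then (1 : ℝ) else 0) ≤ 1 / 32 := by
  set t := ∑ a, lam a with ht
  have ht0 : 0 ≤ t := Finset.sum_nonneg fun a _ => h0 a
  have hrr : (0 : ℝ) < r := by exact_mod_cast hr
  -- Chosen so that θ / (16α) = 8r + t / (2α): the exponential moment is paid for and e^(-8r) is
  -- left.
  set θ := 128 * α * r + 8 * t with hθ
  have hθ0 : 0 < θ := by positivity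
  let z : (Fin r → ℝ) → (Fin r × ι → ℤˣ) → ι → ℝ := fun u ω => u ᵥ* signMatrix ω
  let q : (Fin r → ℝ) → (Fin r × ι → ℤˣ) → ℝ := fun u ω => ∑ a, lam a * z u ω a ^ 2
  let y : (Fin r → ℝ) → (Fin r × ι → ℤˣ) → (Fin r × ι → ℤˣ) → ℝ := fun u ω η =>
    ∑ i, (signMatrix η *ᵥ (A i *ᵥ z u ω)) ⬝ᵥ (signMatrix η *ᵥ (A i *ᵥ z u ω))
  -- Exponential Markov as pointwise majorants: `f1` is at least 1 when the first tail event occurs,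
  -- `f2` when only the second does, as 34r / 4 ≥ 8r + r / 2.
  let f1 : (Fin r → ℝ) → (Fin r × ι → ℤˣ) → ℝ := fun u ω =>
    Real.exp (-(8 * r)) * (Real.exp (-(t / (2 * α))) * Real.exp (q u ω / (16 * α)))
  let f2 : (Fin r → ℝ) → (Fin r × ι → ℤˣ) → (Fin r × ι → ℤˣ) → ℝ := fun u ω η =>
    if q u ω ≤ θ then
      Real.exp (-(8 * r)) * (Real.exp (-(r / 2)) * Real.exp (y u ω η / (4 * θ))) else 0
  have f1_nonneg : ∀ u ω, 0 ≤ f1 u ω := fun u ω => by positivity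
  have f2_nonneg : ∀ u ω η, 0 ≤ f2 u ω η := fun u ω η => by
    simp only [f2]; split_ifs <;> positivity
  have hpt : ∀ ω η, (if ∃ u ∈ N, 34 * r * θ < y u ω η then (1 : ℝ) else 0) ≤
      ∑ u ∈ N, (f1 u ω + f2 u ω η) := by
    intro ω η
    split_ifs with hb
    · obtain ⟨u, hu, hlt⟩ := hb
      refine le_trans ?_ (Finset.single_le_sum (f := fun u => f1 u ω + f2 u ω η)
        (fun u _ => add_nonneg (f1_nonneg u ω) (f2_nonneg u ω η)) hu)
      by_cases hq : q u ω ≤ θ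
      · refine le_trans ?_ (le_add_of_nonneg_left (f1_nonneg u ω))
        simp only [f2, if_pos hq]
        rw [← Real.exp_add, ← Real.exp_add]
        apply Real.one_le_exp
        have : 34 * r / 4 ≤ y u ω η / (4 * θ) := by
          rw [div_le_div_iff₀ (by norm_num) (by positivity)]
          nlinarith
        linarith
      · refine le_trans ?_ (le_add_of_nonneg_right (f2_nonneg u ω η))
        simp only [f1]
        rw [← Real.exp_add, ← Real.exp_add]
        apply Real.one_le_exp
        have : 8 * r + t / (2 * α) ≤ q u ω / (16 * α) := by
          rw [le_div_iff₀ (by positivity)]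
          have : (8 * r + t / (2 * α)) * (16 * α) = θ := by rw [hθ]; field_simp; ring
          rw [this]
          exact (not_le.1 hq).le
        linarith
    · exact Finset.sum_nonneg fun u _ => add_nonneg (f1_nonneg u ω) (f2_nonneg u ω η)
  have hE1 : ∀ u ∈ N, 𝔼 ω, f1 u ω ≤ Real.exp (-(8 * r)) := by
    intro u hu
    simp only [f1]
    rw [← Finset.mul_expect, ← Finset.mul_expect]
    have h := expect_exp_sum_vecMul_le u (hN u hu) lam hα h0 h1
    have h2 := mul_le_mul_of_nonneg_left h (Real.exp_pos (-(t / (2 * α)))).le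
    rw [← Real.exp_add, ← ht, neg_add_cancel, Real.exp_zero] at h2
    exact mul_le_of_le_one_right (Real.exp_pos _).le h2
  have hE2 : ∀ u ω, 𝔼 η, f2 u ω η ≤ Real.exp (-(8 * r)) := by
    intro u ω
    simp only [f2]
    split_ifs with hq
    · rw [← Finset.mul_expect, ← Finset.mul_expect]
      have h := expect_exp_sum_mulVec_le (ρ := Fin r) (fun i => A i *ᵥ z u ω) hθ0
        (by rw [hquad]; exact hq)
      rw [Fintype.card_fin] at h
      have h2 := mul_le_mul_of_nonneg_left h (Real.exp_pos (-(r / 2 : ℝ))).le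
      rw [← Real.exp_add, neg_add_cancel, Real.exp_zero] at h2
      exact mul_le_of_le_one_right (Real.exp_pos _).le h2
    · simpa using (Real.exp_pos _).le
  calc _ ≤ 𝔼 ω, 𝔼 η, ∑ u ∈ N, (f1 u ω + f2 u ω η) :=
        Finset.expect_le_expect fun ω _ => Finset.expect_le_expect fun η _ => hpt ω η
    _ = ∑ u ∈ N, (𝔼 ω, f1 u ω + 𝔼 ω, 𝔼 η, f2 u ω η) := by
        simp only [Finset.expect_sum_comm, Finset.expect_add_distrib, Fintype.expect_const]
    _ ≤ ∑ u ∈ N, (Real.exp (-(8 * r)) + Real.exp (-(8 * r))) := by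
        refine Finset.sum_le_sum fun u hu => add_le_add (hE1 u hu) ?_
        exact Finset.expect_le Finset.univ_nonempty fun ω _ => hE2 u ω
    _ = 2 * (N.card * Real.exp (-(8 * r))) := by
        rw [Finset.sum_const, nsmul_eq_mul]; ring
    _ ≤ 2 * (32 ^ r * Real.exp (-(8 * r))) := by gcongr
    _ ≤ 1 / 32 := by linarith [exp_neg_eight_mul_le hr]

/-- The bilinear form `(x, v) ↦ xᵀ Wᵀ W v / |S|`, with the rows of `W` restricted to `S`. -/
noncomputable def sketchForm {ρ : Type*} (W : Matrix ρ ι ℝ) (S : Finset ρ) (x v : ι → ℝ) : ℝ :=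
  (∑ j ∈ S, (W j ⬝ᵥ x) * (W j ⬝ᵥ v)) / S.card

/-- The vector `Wᵀ W x / |S|`, with the rows of `W` restricted to `S`. -/
noncomputable def sketchVec {ρ : Type*} (W : Matrix ρ ι ℝ) (S : Finset ρ) (x : ι → ℝ) : ι → ℝ :=
  (S.card : ℝ)⁻¹ • ∑ j ∈ S, (W j ⬝ᵥ x) • W j

lemma dotProduct_sketchVec {ρ : Type*} (W : Matrix ρ ι ℝ) (S : Finset ρ) (x v : ι → ℝ) :
    v ⬝ᵥ sketchVec W S x = sketchForm W S v x := by
  rw [sketchVec, sketchForm, dotProduct_smul, dotProduct_sum, smul_eq_mul, div_eq_inv_mul]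
  congr 1
  refine Finset.sum_congr rfl fun j _ => ?_
  rw [dotProduct_smul, smul_eq_mul, dotProduct_comm v, mul_comm]

lemma expect_sketchForm_sub_sq_le [DecidableEq ι] {ρ : Type*} [Fintype ρ] [DecidableEq ρ]
    (S : Finset ρ) (hS : 0 < S.card) (x v : ι → ℝ) :
    𝔼 ω : ρ × ι → ℤˣ, (sketchForm (signMatrix ω) S x v - x ⬝ᵥ v) ^ 2 ≤
      3 / S.card * (x ⬝ᵥ x) * (v ⬝ᵥ v) := by
  have hc : (0 : ℝ) < S.card := by exact_mod_cast hS
  have h := expect_sq_sum_rows_le x v S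
  have e : ∀ ω : ρ × ι → ℤˣ, (sketchForm (signMatrix ω) S x v - x ⬝ᵥ v) ^ 2 =
      ((S.card : ℝ) ^ 2)⁻¹ *
        (∑ j ∈ S, ((signMatrix ω j ⬝ᵥ x) * (signMatrix ω j ⬝ᵥ v) - x ⬝ᵥ v)) ^ 2 := by
    intro ω
    rw [Finset.sum_sub_distrib, Finset.sum_const, nsmul_eq_mul, sketchForm]
    field_simp
  simp_rw [e]
  rw [← Finset.mul_expect]
  calc _ ≤ ((S.card : ℝ) ^ 2)⁻¹ * (S.card * (3 * (x ⬝ᵥ x) * (v ⬝ᵥ v))) := by gcongr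
    _ = _ := by field_simp

/-- Split xᵀP A_i Q x - xᵀA_i x as xᵀ(P - 1)A_i Q x + xᵀA_i(Q - 1)x. The second part is a variance
in η. The first, for fixed η, is a variance in ω of size ∑ ‖A_i Q x‖² / r, whose mean is computed
coordinatewise because ∑ A_i² is diagonal. -/
lemma expect_sketch_error_le [DecidableEq ι] (A : Fin n → Matrix ι ι ℝ) (hA : ∀ i, (A i).IsSymm)
    (lam : ι → ℝ) {α : ℝ} (h0 : ∀ a, 0 ≤ lam a) (h1 : ∀ a, lam a ≤ α) (hα : 0 < α)
    (hquad : ∀ z, ∑ i, (A i *ᵥ z) ⬝ᵥ (A i *ᵥ z) = ∑ a, lam a * z a ^ 2)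
    (hr : 0 < r) (S T : Finset (Fin r)) (hS : r ≤ 3 * S.card) (hT : r ≤ 3 * T.card)
    (x : ι → ℝ) (hx : x ⬝ᵥ x = 1) :
    𝔼 ω : Fin r × ι → ℤˣ, 𝔼 η : Fin r × ι → ℤˣ,
      ∑ i, (sketchForm (signMatrix ω) S x (A i *ᵥ sketchVec (signMatrix η) T x) -
        x ⬝ᵥ (A i *ᵥ x)) ^ 2 ≤ 324 * ((α + (∑ a, lam a) / r) / r) := by
  have hrr : (0 : ℝ) < r := by exact_mod_cast hr
  have hS' : (r : ℝ) ≤ 3 * S.card := by exact_mod_cast hS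
  have hT' : (r : ℝ) ≤ 3 * T.card := by exact_mod_cast hT
  have hS0 : 0 < S.card := by omega
  have hT0 : 0 < T.card := by omega
  have hS3 : 3 / (S.card : ℝ) ≤ 9 / r := by
    rw [div_le_div_iff₀ (by exact_mod_cast hS0) hrr]; linarith
  have hT3 : 3 / (T.card : ℝ) ≤ 9 / r := by
    rw [div_le_div_iff₀ (by exact_mod_cast hT0) hrr]; linarith
  set t := ∑ a, lam a with ht
  have ht0 : 0 ≤ t := Finset.sum_nonneg fun a _ => h0 a
  set Q : (Fin r × ι → ℤˣ) → ι → ℝ := fun η => sketchVec (signMatrix η) T x with hQ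
  have hQa : ∀ η a, Q η a = sketchForm (signMatrix η) T (Pi.single a 1) x := fun η a => by
    rw [← dotProduct_sketchVec, single_dotProduct, one_mul]
  have hxA : ∀ i v, x ⬝ᵥ (A i *ᵥ v) = (A i *ᵥ x) ⬝ᵥ v := fun i v => by
    rw [Matrix.dotProduct_mulVec, ← Matrix.mulVec_transpose, (hA i).eq]
  have hsumx : ∑ a, lam a * x a ^ 2 ≤ α := by
    calc ∑ a, lam a * x a ^ 2 ≤ ∑ a, α * x a ^ 2 := by
          gcongr with a _
          exact h1 a
      _ = α * (x ⬝ᵥ x) := by rw [← Finset.mul_sum, dotProduct]; simp only [pow_two]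
      _ = α := by rw [hx, mul_one]
  have hE1 : 𝔼 η, ∑ i, (A i *ᵥ Q η) ⬝ᵥ (A i *ᵥ Q η) ≤ 2 * α + 18 / r * t := by
    simp_rw [hquad]
    rw [Finset.expect_sum_comm]
    calc ∑ a, 𝔼 η, lam a * Q η a ^ 2 ≤ ∑ a, lam a * (2 * (9 / r) + 2 * x a ^ 2) := by
          refine Finset.sum_le_sum fun a _ => ?_
          rw [← Finset.mul_expect]
          refine mul_le_mul_of_nonneg_left ?_ (h0 a)
          have h := expect_sketchForm_sub_sq_le T hT0 (Pi.single a 1) x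
          have he : Pi.single a 1 ⬝ᵥ Pi.single a 1 = (1 : ℝ) := by
            rw [single_dotProduct, Pi.single_eq_same, one_mul]
          rw [hx, he, single_dotProduct, one_mul, mul_one, mul_one] at h
          calc 𝔼 η, Q η a ^ 2
              ≤ 𝔼 η, (2 * (sketchForm (signMatrix η) T (Pi.single a 1) x - x a) ^ 2 +
                  2 * x a ^ 2) := by
                refine Finset.expect_le_expect fun η _ => ?_
                rw [hQa]
                nlinarith [sq_nonneg (sketchForm (signMatrix η) T (Pi.single a 1) x - 2 * x a)]
            _ ≤ _ := by
                rw [Finset.expect_add_distrib, ← Finset.mul_expect, Fintype.expect_const]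
                linarith
      _ = 2 * ∑ a, lam a * x a ^ 2 + 18 / r * t := by
          rw [ht, Finset.mul_sum, Finset.mul_sum, ← Finset.sum_add_distrib]
          refine Finset.sum_congr rfl fun a _ => ?_
          ring
      _ ≤ _ := by linarith
  have hE2 : 𝔼 η, ∑ i, (x ⬝ᵥ (A i *ᵥ Q η) - x ⬝ᵥ (A i *ᵥ x)) ^ 2 ≤ 9 / r * α := by
    rw [Finset.expect_sum_comm]
    calc ∑ i, 𝔼 η, (x ⬝ᵥ (A i *ᵥ Q η) - x ⬝ᵥ (A i *ᵥ x)) ^ 2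
        ≤ ∑ i, 9 / r * ((A i *ᵥ x) ⬝ᵥ (A i *ᵥ x)) := by
          refine Finset.sum_le_sum fun i _ => ?_
          simp_rw [hxA, hQ, dotProduct_sketchVec]
          refine (expect_sketchForm_sub_sq_le T hT0 (A i *ᵥ x) x).trans ?_
          rw [hx, mul_one]
          exact mul_le_mul_of_nonneg_right hT3 (dotProduct_self_nonneg' _)
      _ ≤ 9 / r * α := by
          rw [← Finset.mul_sum, hquad]
          gcongr
  calc _ ≤ 𝔼 ω : Fin r × ι → ℤˣ, 𝔼 η : Fin r × ι → ℤˣ,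
        (2 * ∑ i, (sketchForm (signMatrix ω) S x (A i *ᵥ Q η) - x ⬝ᵥ (A i *ᵥ Q η)) ^ 2 +
          2 * ∑ i, (x ⬝ᵥ (A i *ᵥ Q η) - x ⬝ᵥ (A i *ᵥ x)) ^ 2) := by
        refine Finset.expect_le_expect fun ω _ => Finset.expect_le_expect fun η _ => ?_
        rw [Finset.mul_sum, Finset.mul_sum, ← Finset.sum_add_distrib]
        refine Finset.sum_le_sum fun i _ => ?_
        have := add_sq_le (a := sketchForm (signMatrix ω) S x (A i *ᵥ Q η) - x ⬝ᵥ (A i *ᵥ Q η))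
          (b := x ⬝ᵥ (A i *ᵥ Q η) - x ⬝ᵥ (A i *ᵥ x))
        rw [sub_add_sub_cancel] at this
        linarith
    _ = 2 * (𝔼 η : Fin r × ι → ℤˣ, ∑ i, 𝔼 ω : Fin r × ι → ℤˣ,
          (sketchForm (signMatrix ω) S x (A i *ᵥ Q η) - x ⬝ᵥ (A i *ᵥ Q η)) ^ 2) +
        2 * 𝔼 η, ∑ i, (x ⬝ᵥ (A i *ᵥ Q η) - x ⬝ᵥ (A i *ᵥ x)) ^ 2 := by
        simp only [Finset.expect_add_distrib, ← Finset.mul_expect, Fintype.expect_const]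
        rw [Finset.expect_comm]
        simp only [Finset.expect_sum_comm]
    _ ≤ 2 * (𝔼 η : Fin r × ι → ℤˣ, 9 / r * ∑ i, (A i *ᵥ Q η) ⬝ᵥ (A i *ᵥ Q η)) +
        2 * (9 / r * α) := by
        gcongr with η _
        rw [Finset.mul_sum]
        refine Finset.sum_le_sum fun i _ => ?_
        refine (expect_sketchForm_sub_sq_le S hS0 x (A i *ᵥ Q η)).trans ?_
        rw [hx, mul_one]
        exact mul_le_mul_of_nonneg_right hS3 (dotProduct_self_nonneg' _)
    _ ≤ 2 * (9 / r * (2 * α + 18 / r * t)) + 2 * (9 / r * α) := by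
        rw [← Finset.mul_expect]
        gcongr
    -- 324 = 2 · 9 · 18 is the coefficient of t / r²; that of α / r is only 54.
    _ = 324 * ((α + t / r) / r) - 270 * α / r := by field_simp; ring
    _ ≤ _ := by
        have : 0 ≤ 270 * α / r := by positivity
        linarith

end Sketch

/-! ### The block off-diagonal sketch -/

section Core

open scoped Matrix

variable {ι : Type*} {n r : ℕ}

/-- The matrix obtained from `W` by replacing the rows outside `S` with zero. -/
def restrictRows {ρ : Type*} [DecidableEq ρ] (S : Finset ρ) (W : Matrix ρ ι ℝ) : Matrix ρ ι ℝ :=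
  Matrix.of fun j => if j ∈ S then W j else 0

section Restrict

variable {ρ : Type*} [DecidableEq ρ] [Fintype ρ]

lemma vecMul_restrictRows (S : Finset ρ) (W : Matrix ρ ι ℝ) (v : ρ → ℝ) :
    v ᵥ* restrictRows S W = ∑ j ∈ S, v j • W j := by
  ext a
  simp only [Matrix.vecMul, dotProduct, restrictRows, Matrix.of_apply, Finset.sum_apply,
    Pi.smul_apply, smul_eq_mul]
  rw [← Finset.sum_subset (Finset.subset_univ S)]
  · exact Finset.sum_congr rfl fun j hj => by rw [if_pos hj]
  · intro j _ hj
    rw [if_neg hj]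
    simp

lemma vecMul_restrictRows_eq (S : Finset ρ) (W : Matrix ρ ι ℝ) (v : ρ → ℝ) :
    v ᵥ* restrictRows S W = (fun j => if j ∈ S then v j else 0) ᵥ* W := by
  ext a
  simp only [Matrix.vecMul, dotProduct, restrictRows, Matrix.of_apply]
  refine Finset.sum_congr rfl fun j _ => ?_
  split_ifs <;> simp

variable [Fintype ι]

lemma restrictRows_mulVec_dotProduct_self_le (S : Finset ρ) (W : Matrix ρ ι ℝ) (w : ι → ℝ) :
    (restrictRows S W *ᵥ w) ⬝ᵥ (restrictRows S W *ᵥ w) ≤ (W *ᵥ w) ⬝ᵥ (W *ᵥ w) := by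
  refine Finset.sum_le_sum fun j _ => ?_
  simp only [Matrix.mulVec, restrictRows, Matrix.of_apply]
  split_ifs
  · rfl
  · simp only [zero_dotProduct, mul_zero]
    exact mul_self_nonneg _

lemma ite_dotProduct_self_add (S : Finset ρ) (v : ρ → ℝ) :
    (fun j => if j ∈ S then v j else 0) ⬝ᵥ (fun j => if j ∈ S then v j else 0) +
      (fun j => if j ∈ Sᶜ then v j else 0) ⬝ᵥ (fun j => if j ∈ Sᶜ then v j else 0) = v ⬝ᵥ v := by
  simp only [dotProduct]
  rw [← Finset.sum_add_distrib]
  refine Finset.sum_congr rfl fun j _ => ?_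
  by_cases h : j ∈ S <;> simp [h]

end Restrict

lemma add_dotProduct_self_le {ρ : Type*} [Fintype ρ] (v w : ρ → ℝ) : (v + w) ⬝ᵥ (v + w) ≤ 2 * (v ⬝ᵥ v + w ⬝ᵥ w) := by
  have := dotProduct_self_nonneg' (v - w)
  simp only [add_dotProduct, dotProduct_add, sub_dotProduct, dotProduct_sub] at this ⊢
  linarith

variable [Fintype ι]

lemma sketchForm_comm {ρ : Type*} (W : Matrix ρ ι ℝ) (S : Finset ρ) (x v : ι → ℝ) :
    sketchForm W S x v = sketchForm W S v x := by
  simp only [sketchForm, mul_comm]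

lemma card_smul_sketchVec {ρ : Type*} (W : Matrix ρ ι ℝ) {S : Finset ρ} (hS : 0 < S.card)
    (x : ι → ℝ) : (S.card : ℝ) • sketchVec W S x = ∑ j ∈ S, (W j ⬝ᵥ x) • W j := by
  rw [sketchVec, smul_inv_smul₀]
  exact_mod_cast hS.ne'

/-- The symmetric sketch of `A` whose off-diagonal blocks are `U A Vᵀ / r` and its transpose, with
the rows of `U` restricted to `S` and those of `V` to the complement. -/
noncomputable def sketchMatrix (S : Finset (Fin r)) (U V : Matrix (Fin r) ι ℝ) (A : Matrix ι ι ℝ) :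
    Matrix (Fin r) (Fin r) ℝ :=
  (r : ℝ)⁻¹ • (restrictRows S U * A * (restrictRows Sᶜ V)ᵀ +
    (restrictRows S U * A * (restrictRows Sᶜ V)ᵀ)ᵀ)

lemma sketchMatrix_isSymm (S : Finset (Fin r)) (U V : Matrix (Fin r) ι ℝ) (A : Matrix ι ι ℝ) :
    (sketchMatrix S U V A).IsSymm := by
  rw [sketchMatrix, Matrix.IsSymm, Matrix.transpose_smul, Matrix.transpose_add,
    Matrix.transpose_transpose, add_comm]

lemma sketchMatrix_mulVec (S : Finset (Fin r)) (U V : Matrix (Fin r) ι ℝ) {A : Matrix ι ι ℝ}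
    (hA : A.IsSymm) (v : Fin r → ℝ) :
    sketchMatrix S U V A *ᵥ v = (r : ℝ)⁻¹ •
      (restrictRows S U *ᵥ (A *ᵥ (v ᵥ* restrictRows Sᶜ V)) +
        restrictRows Sᶜ V *ᵥ (A *ᵥ (v ᵥ* restrictRows S U))) := by
  rw [sketchMatrix, Matrix.smul_mulVec, Matrix.add_mulVec, Matrix.transpose_mul,
    Matrix.transpose_mul, Matrix.transpose_transpose, hA.eq]
  simp only [← Matrix.mulVec_mulVec, Matrix.mulVec_transpose]

/-- The two blocks read complementary halves of v, so their bounds add up to one multiple of ‖v‖²;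
deleting rows of the outer factor only decreases norms. -/
lemma sum_sketchMatrix_mulVec_le (S : Finset (Fin r)) (U V : Matrix (Fin r) ι ℝ)
    (A : Fin n → Matrix ι ι ℝ) (hA : ∀ i, (A i).IsSymm) {c : ℝ}
    (hUV : ∀ v : Fin r → ℝ,
      ∑ i, (U *ᵥ (A i *ᵥ (v ᵥ* V))) ⬝ᵥ (U *ᵥ (A i *ᵥ (v ᵥ* V))) ≤ c * (v ⬝ᵥ v))
    (hVU : ∀ v : Fin r → ℝ,
      ∑ i, (V *ᵥ (A i *ᵥ (v ᵥ* U))) ⬝ᵥ (V *ᵥ (A i *ᵥ (v ᵥ* U))) ≤ c * (v ⬝ᵥ v))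
    (v : Fin r → ℝ) :
    ∑ i, (sketchMatrix S U V (A i) *ᵥ v) ⬝ᵥ (sketchMatrix S U V (A i) *ᵥ v) ≤
      2 * c / r ^ 2 * (v ⬝ᵥ v) := by
  set vS : Fin r → ℝ := fun j => if j ∈ S then v j else 0
  set vT : Fin r → ℝ := fun j => if j ∈ Sᶜ then v j else 0
  have hsplit : vS ⬝ᵥ vS + vT ⬝ᵥ vT = v ⬝ᵥ v := ite_dotProduct_self_add S v
  have hi : ∀ i, (sketchMatrix S U V (A i) *ᵥ v) ⬝ᵥ (sketchMatrix S U V (A i) *ᵥ v) ≤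
      2 / r ^ 2 * ((U *ᵥ (A i *ᵥ (vT ᵥ* V))) ⬝ᵥ (U *ᵥ (A i *ᵥ (vT ᵥ* V))) +
        (V *ᵥ (A i *ᵥ (vS ᵥ* U))) ⬝ᵥ (V *ᵥ (A i *ᵥ (vS ᵥ* U)))) := by
    intro i
    rw [sketchMatrix_mulVec S U V (hA i), smul_dotProduct, dotProduct_smul, smul_eq_mul,
      smul_eq_mul, ← mul_assoc]
    have eS : v ᵥ* restrictRows S U = vS ᵥ* U := vecMul_restrictRows_eq S U v
    have eT : v ᵥ* restrictRows Sᶜ V = vT ᵥ* V := vecMul_restrictRows_eq Sᶜ V v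
    rw [eS, eT]
    have h1 := restrictRows_mulVec_dotProduct_self_le S U (A i *ᵥ (vT ᵥ* V))
    have h2 := restrictRows_mulVec_dotProduct_self_le Sᶜ V (A i *ᵥ (vS ᵥ* U))
    have h3 := add_dotProduct_self_le (restrictRows S U *ᵥ (A i *ᵥ (vT ᵥ* V)))
      (restrictRows Sᶜ V *ᵥ (A i *ᵥ (vS ᵥ* U)))
    rw [show 2 / (r : ℝ) ^ 2 = (r : ℝ)⁻¹ * (r : ℝ)⁻¹ * 2 by field_simp, mul_assoc _ 2]
    exact mul_le_mul_of_nonneg_left (by linarith) (by positivity)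
  refine (Finset.sum_le_sum fun i _ => hi i).trans ?_
  rw [← Finset.mul_sum, Finset.sum_add_distrib, ← hsplit]
  calc _ ≤ 2 / (r : ℝ) ^ 2 * (c * (vT ⬝ᵥ vT) + c * (vS ⬝ᵥ vS)) :=
        mul_le_mul_of_nonneg_left (add_le_add (hUV vT) (hVU vS)) (by positivity)
    _ = _ := by ring

/-- The sketch of the vector `x`: the entries of `U x` on `S` and those of `V x` elsewhere. -/
def sketchPoint (S : Finset (Fin r)) (U V : Matrix (Fin r) ι ℝ) (x : ι → ℝ) : Fin r → ℝ :=
  fun j => if j ∈ S then U j ⬝ᵥ x else V j ⬝ᵥ x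

lemma sketchPoint_dotProduct_self (S : Finset (Fin r)) (hS : 0 < S.card) (hT : 0 < Sᶜ.card)
    (U V : Matrix (Fin r) ι ℝ) (x : ι → ℝ) :
    sketchPoint S U V x ⬝ᵥ sketchPoint S U V x =
      S.card * sketchForm U S x x + Sᶜ.card * sketchForm V Sᶜ x x := by
  have hS' : (S.card : ℝ) ≠ 0 := by exact_mod_cast hS.ne'
  have hT' : (Sᶜ.card : ℝ) ≠ 0 := by exact_mod_cast hT.ne'
  rw [sketchForm, sketchForm, mul_div_cancel₀ _ hS', mul_div_cancel₀ _ hT', dotProduct,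
    ← Finset.sum_add_sum_compl S]
  congr 1
  · exact Finset.sum_congr rfl fun j hj => by rw [sketchPoint, if_pos hj]
  · exact Finset.sum_congr rfl fun j hj => by
      rw [sketchPoint, if_neg (Finset.mem_compl.1 hj)]

/-- The two blocks contribute equally. Only products of a `U` factor and a `V` factor appear, so
independent `U` and `V` leave no diagonal bias. -/
lemma sketchPoint_dotProduct_sketchMatrix (S : Finset (Fin r)) (hS : 0 < S.card)
    (hT : 0 < Sᶜ.card) (U V : Matrix (Fin r) ι ℝ) {A : Matrix ι ι ℝ} (hA : A.IsSymm)
    (x : ι → ℝ) :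
    sketchPoint S U V x ⬝ᵥ (sketchMatrix S U V A *ᵥ sketchPoint S U V x) =
      2 * S.card * Sᶜ.card / r * sketchForm U S x (A *ᵥ sketchVec V Sᶜ x) := by
  have hU : sketchPoint S U V x ᵥ* restrictRows S U = (S.card : ℝ) • sketchVec U S x := by
    rw [card_smul_sketchVec U hS, vecMul_restrictRows]
    exact Finset.sum_congr rfl fun j hj => by rw [sketchPoint, if_pos hj]
  have hV : sketchPoint S U V x ᵥ* restrictRows Sᶜ V = (Sᶜ.card : ℝ) • sketchVec V Sᶜ x := by
    rw [card_smul_sketchVec V hT, vecMul_restrictRows]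
    exact Finset.sum_congr rfl fun j hj => by
      rw [sketchPoint, if_neg (Finset.mem_compl.1 hj)]
  have hcomm : sketchVec V Sᶜ x ⬝ᵥ (A *ᵥ sketchVec U S x) =
      sketchVec U S x ⬝ᵥ (A *ᵥ sketchVec V Sᶜ x) := by
    rw [dotProduct_comm, Matrix.dotProduct_mulVec, ← Matrix.mulVec_transpose, hA.eq,
      dotProduct_comm]
  rw [sketchMatrix_mulVec S U V hA, dotProduct_smul, dotProduct_add, Matrix.dotProduct_mulVec,
    Matrix.dotProduct_mulVec (sketchPoint S U V x) (restrictRows Sᶜ V), hU, hV]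
  simp only [Matrix.mulVec_smul, dotProduct_smul, smul_dotProduct, smul_eq_mul, hcomm]
  rw [dotProduct_comm, dotProduct_sketchVec, sketchForm_comm]
  ring

lemma exists_half_finset (hr : 2 ≤ r) : ∃ S : Finset (Fin r),
    r ≤ 3 * S.card ∧ r ≤ 3 * Sᶜ.card := by
  obtain ⟨S, -, hS⟩ := Finset.exists_subset_card_eq (s := (Finset.univ : Finset (Fin r)))
    (n := r / 2) (by simp; omega)
  refine ⟨S, by omega, ?_⟩
  rw [Finset.card_compl, Fintype.card_fin]
  omega

/-- Here p, q are the block sizes and a, b the values of the two sketched forms at x, within 1/2 of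
1. The ratio is the multiplier c; the upper bound 1 ensures that scaling by c does not enlarge the
error. -/
lemma sketch_parameters {p q ρ a b : ℝ} (hp : ρ ≤ 3 * p) (hq : ρ ≤ 3 * q) (hpq : p + q = ρ)
    (hρ : 0 < ρ) (ha : (a - 1) ^ 2 ≤ 1 / 4) (hb : (b - 1) ^ 2 ≤ 1 / 4) :
    0 < p * a + q * b ∧ 1 / 9 ≤ 2 * p * q / ρ / (p * a + q * b) ∧
      2 * p * q / ρ / (p * a + q * b) ≤ 1 := by
  have ha' := abs_le_of_sq_le_sq (show (a - 1) ^ 2 ≤ (1 / 2) ^ 2 by linarith) (by norm_num)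
  have hb' := abs_le_of_sq_le_sq (show (b - 1) ^ 2 ≤ (1 / 2) ^ 2 by linarith) (by norm_num)
  rw [abs_le] at ha' hb'
  have hp0 : 0 < p := by linarith
  have hq0 : 0 < q := by linarith
  have h1 : ρ / 2 ≤ p * a + q * b := by nlinarith
  have h2 : p * a + q * b ≤ 3 * ρ / 2 := by nlinarith
  have h0 : 0 < p * a + q * b := by linarith
  refine ⟨h0, ?_, ?_⟩
  · rw [div_div, div_le_div_iff₀ (by norm_num) (by positivity)]
    nlinarith [mul_le_mul hp hq hρ.le (by linarith)]
  · rw [div_div, div_le_one (by positivity)]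
    nlinarith [sq_nonneg (p - q)]

end Core

/-! ### Choosing the signs -/

section Core

open scoped Matrix

variable {ι : Type*} [Fintype ι] [DecidableEq ι] {n r : ℕ}

/-- Markov's inequality at level 1. -/
lemma card_filter_lt_one_ge {γ : Type*} [Fintype γ] [Nonempty γ] (f : γ → ℝ) (hf : ∀ g, 0 ≤ f g)
    (h : 𝔼 g, f g ≤ 1 / 4) :
    (3 / 4 : ℝ) * Fintype.card γ ≤ ((Finset.univ.filter fun g => f g < 1).card : ℝ) := by
  classical
  have hγ : (0 : ℝ) < Fintype.card γ := by exact_mod_cast Fintype.card_pos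
  rw [Fintype.expect_eq_sum_div_card, div_le_iff₀ hγ] at h
  have h1 : ((Finset.univ.filter fun g => ¬ f g < 1).card : ℝ) ≤ ∑ g, f g := by
    calc ((Finset.univ.filter fun g => ¬ f g < 1).card : ℝ)
        = ∑ g ∈ Finset.univ.filter (fun g => ¬ f g < 1), (1 : ℝ) := by simp
      _ ≤ ∑ g ∈ Finset.univ.filter (fun g => ¬ f g < 1), f g :=
          Finset.sum_le_sum fun g hg => not_lt.1 (Finset.mem_filter.1 hg).2
      _ ≤ ∑ g, f g := Finset.sum_le_sum_of_subset_of_nonneg (Finset.filter_subset _ _)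
          fun g _ _ => hf g
  have h2 : ((Finset.univ.filter fun g => f g < 1).card : ℝ) +
      ((Finset.univ.filter fun g => ¬ f g < 1).card : ℝ) = Fintype.card γ := by
    exact_mod_cast Finset.card_filter_add_card_filter_not (s := Finset.univ) (fun g => f g < 1)
  linarith

open Classical in
-- First-moment method: the two net failures have mean at most 1/32 each and the g-averaged defect
-- `f` at most 3/64, in total below 1/4. A single pair of sign matrices therefore avoids both
-- failures and has mean defect at most 1/4.
lemma exists_good_signs (A : Fin n → Matrix ι ι ℝ) (hA : ∀ i, (A i).IsSymm)
    (lam : ι → ℝ) {α : ℝ} (h0 : ∀ a, 0 ≤ lam a) (h1 : ∀ a, lam a ≤ α) (hα : 0 < α)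
    (hquad : ∀ z, ∑ i, (A i *ᵥ z) ⬝ᵥ (A i *ᵥ z) = ∑ a, lam a * z a ^ 2)
    (hr : 2304 ≤ r) {γ : Type*} [Fintype γ] [Nonempty γ] (x : γ → ι → ℝ)
    (hx : ∀ g, x g ⬝ᵥ x g = 1) (S T : Finset (Fin r)) (hS : r ≤ 3 * S.card) (hT : r ≤ 3 * T.card)
    (N : Finset (Fin r → ℝ)) (hcard : (N.card : ℝ) ≤ 32 ^ r) (hN : ∀ u ∈ N, u ⬝ᵥ u ≤ 4) :
    ∃ U V : Matrix (Fin r) ι ℝ,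
      (∀ u ∈ N, ∑ i, (V *ᵥ (A i *ᵥ (u ᵥ* U))) ⬝ᵥ (V *ᵥ (A i *ᵥ (u ᵥ* U))) ≤
        34 * r * (128 * α * r + 8 * ∑ a, lam a)) ∧
      (∀ u ∈ N, ∑ i, (U *ᵥ (A i *ᵥ (u ᵥ* V))) ⬝ᵥ (U *ᵥ (A i *ᵥ (u ᵥ* V))) ≤
        34 * r * (128 * α * r + 8 * ∑ a, lam a)) ∧
      ∃ G : Finset γ, (3 / 4 : ℝ) * Fintype.card γ ≤ (G.card : ℝ) ∧ ∀ g ∈ G,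
        (sketchForm U S (x g) (x g) - 1) ^ 2 ≤ 1 / 4 ∧
        (sketchForm V T (x g) (x g) - 1) ^ 2 ≤ 1 / 4 ∧
        ∑ i, (sketchForm U S (x g) (A i *ᵥ sketchVec V T (x g)) - x g ⬝ᵥ (A i *ᵥ x g)) ^ 2 ≤
          20736 * ((α + (∑ a, lam a) / r) / r) := by
  have hr0 : 0 < r := by omega
  have hrr : (2304 : ℝ) ≤ r := by exact_mod_cast hr
  have hrr0 : (0 : ℝ) < r := by linarith
  have ht0 : 0 ≤ ∑ a, lam a := Finset.sum_nonneg fun a _ => h0 a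
  set L := (α + (∑ a, lam a) / r) / r with hL
  have hL0 : 0 < L := by positivity
  let bad : (Fin r × ι → ℤˣ) → (Fin r × ι → ℤˣ) → ℝ := fun ω η =>
    if ∃ u ∈ N, 34 * r * (128 * α * r + 8 * ∑ a, lam a) <
        ∑ i, (signMatrix η *ᵥ (A i *ᵥ (u ᵥ* signMatrix ω))) ⬝ᵥ
          (signMatrix η *ᵥ (A i *ᵥ (u ᵥ* signMatrix ω))) then (1 : ℝ) else 0
  have bad_nonneg : ∀ ω η, 0 ≤ bad ω η := fun ω η => by
    simp only [bad]; split_ifs <;> norm_num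
  have good_of_bad_lt : ∀ ω η, bad ω η < 1 → ∀ u ∈ N,
      ∑ i, (signMatrix η *ᵥ (A i *ᵥ (u ᵥ* signMatrix ω))) ⬝ᵥ
          (signMatrix η *ᵥ (A i *ᵥ (u ᵥ* signMatrix ω))) ≤
        34 * r * (128 * α * r + 8 * ∑ a, lam a) := fun ω η h u hu => by
    by_contra hlt
    have : bad ω η = 1 := if_pos ⟨u, hu, not_le.1 hlt⟩
    linarith
  have hbad : 𝔼 ω, 𝔼 η, bad ω η ≤ 1 / 32 :=
    expect_exists_net_le A lam hα h0 h1 hquad hr0 N hcard hN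
  have hbad' : 𝔼 ω, 𝔼 η, bad η ω ≤ 1 / 32 := by rw [Finset.expect_comm]; exact hbad
  let e : (Fin r × ι → ℤˣ) → (Fin r × ι → ℤˣ) → γ → ℝ := fun ω η g =>
    ∑ i, (sketchForm (signMatrix ω) S (x g) (A i *ᵥ sketchVec (signMatrix η) T (x g)) -
      x g ⬝ᵥ (A i *ᵥ x g)) ^ 2
  have e_nonneg : ∀ ω η g, 0 ≤ e ω η g := fun ω η g => Finset.sum_nonneg fun _ _ => sq_nonneg _
  -- Each term is normalised so that `f < 1` yields all three bounds; 20736 = 64 · 324 makes the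
  -- first have mean at most 1/64.
  let f : (Fin r × ι → ℤˣ) → (Fin r × ι → ℤˣ) → γ → ℝ := fun ω η g =>
    (20736 * L)⁻¹ * e ω η g + (4 * (sketchForm (signMatrix ω) S (x g) (x g) - 1) ^ 2 +
      4 * (sketchForm (signMatrix η) T (x g) (x g) - 1) ^ 2)
  have f_nonneg : ∀ ω η g, 0 ≤ f ω η g := fun ω η g => by
    have := e_nonneg ω η g
    positivity
  -- This fixes the threshold on r: 3 / |R| ≤ 9 / r ≤ 9 / 2304 = 1/256.
  have hvar : ∀ R : Finset (Fin r), r ≤ 3 * R.card → ∀ g, 𝔼 ω : Fin r × ι → ℤˣ,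
      (sketchForm (signMatrix ω) R (x g) (x g) - 1) ^ 2 ≤ 1 / 256 := fun R hR g => by
    have h := expect_sketchForm_sub_sq_le R (by omega) (x g) (x g)
    rw [hx, mul_one, mul_one] at h
    refine h.trans ?_
    have hR' : (r : ℝ) ≤ 3 * R.card := by exact_mod_cast hR
    rw [div_le_div_iff₀ (by linarith) (by norm_num)]
    linarith
  have hf : ∀ g, 𝔼 ω, 𝔼 η, f ω η g ≤ 3 / 64 := by
    intro g
    have he := expect_sketch_error_le A hA lam h0 h1 hα hquad hr0 S T hS hT (x g) (hx g)
    have he' : (20736 * L)⁻¹ * 𝔼 ω, 𝔼 η, e ω η g ≤ 1 / 64 := by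
      rw [inv_mul_le_iff₀ (by positivity)]
      refine he.trans ?_
      rw [← hL]
      linarith
    simp only [f, Finset.expect_add_distrib, ← Finset.mul_expect, Fintype.expect_const]
    linarith [hvar S hS g, hvar T hT g]
  have hF : 𝔼 ω, 𝔼 η, (bad ω η + (bad η ω + 𝔼 g, f ω η g)) < 1 / 4 := by
    simp only [Finset.expect_add_distrib]
    have : 𝔼 ω, 𝔼 η, 𝔼 g, f ω η g ≤ 3 / 64 := by
      have e1 : 𝔼 ω, 𝔼 η, 𝔼 g, f ω η g = 𝔼 g, 𝔼 ω, 𝔼 η, f ω η g := by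
        rw [Finset.expect_comm (s := (Finset.univ : Finset γ))]
        refine Finset.expect_congr rfl fun ω _ => ?_
        rw [Finset.expect_comm]
      rw [e1]
      exact Finset.expect_le Finset.univ_nonempty fun g _ => hf g
    linarith
  obtain ⟨ω, -, hω⟩ := Finset.exists_lt_of_expect_lt Finset.univ_nonempty hF
  obtain ⟨η, -, hη⟩ := Finset.exists_lt_of_expect_lt Finset.univ_nonempty hω
  have hEf : 0 ≤ 𝔼 g, f ω η g := Finset.expect_nonneg fun g _ => f_nonneg ω η g
  have hb1 := bad_nonneg ω η
  have hb2 := bad_nonneg η ω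
  refine ⟨signMatrix ω, signMatrix η, good_of_bad_lt ω η (by linarith),
    good_of_bad_lt η ω (by linarith), Finset.univ.filter fun g => f ω η g < 1,
    card_filter_lt_one_ge _ (f_nonneg ω η) (by linarith), fun g hg => ?_⟩
  have hg : f ω η g < 1 := (Finset.mem_filter.1 hg).2
  simp only [f] at hg
  have s1 := sq_nonneg (sketchForm (signMatrix ω) S (x g) (x g) - 1)
  have s2 := sq_nonneg (sketchForm (signMatrix η) T (x g) (x g) - 1)
  have s3 : 0 ≤ (20736 * L)⁻¹ * e ω η g := mul_nonneg (by positivity) (e_nonneg ω η g)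
  refine ⟨by linarith, by linarith, ?_⟩
  have : (20736 * L)⁻¹ * e ω η g ≤ 1 := by linarith
  rwa [inv_mul_le_iff₀ (by positivity), mul_one] at this

lemma exists_sketch_of_diagonal (A : Fin n → Matrix ι ι ℝ) (hA : ∀ i, (A i).IsSymm)
    (lam : ι → ℝ) {α : ℝ} (h0 : ∀ a, 0 ≤ lam a) (h1 : ∀ a, lam a ≤ α) (hα : 0 < α)
    (hquad : ∀ z, ∑ i, (A i *ᵥ z) ⬝ᵥ (A i *ᵥ z) = ∑ a, lam a * z a ^ 2)
    (hr : 2304 ≤ r) {γ : Type*} [Fintype γ] [Nonempty γ] (x : γ → ι → ℝ)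
    (hx : ∀ g, x g ⬝ᵥ x g = 1) :
    ∃ B : Fin n → Matrix (Fin r) (Fin r) ℝ, (∀ i, (B i).IsSymm) ∧
      (∀ v, ∑ i, (B i *ᵥ v) ⬝ᵥ (B i *ᵥ v) ≤ 34816 * (α + (∑ a, lam a) / r) * (v ⬝ᵥ v)) ∧
      ∃ G : Finset γ, (3 / 4 : ℝ) * Fintype.card γ ≤ (G.card : ℝ) ∧ ∀ g ∈ G,
        ∃ y : Fin r → ℝ, y ⬝ᵥ y = 1 ∧ ∃ c : ℝ, 1 / 9 ≤ c ∧
          ∑ i, (y ⬝ᵥ (B i *ᵥ y) - c * (x g ⬝ᵥ (A i *ᵥ x g))) ^ 2 ≤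
            20736 * ((α + (∑ a, lam a) / r) / r) := by
  have hr0 : 0 < r := by omega
  have hrr : (0 : ℝ) < r := by exact_mod_cast hr0
  have ht0 : 0 ≤ ∑ a, lam a := Finset.sum_nonneg fun a _ => h0 a
  obtain ⟨S, hS, hT⟩ := exists_half_finset (r := r) (by omega)
  obtain ⟨N, hNcard, hN4, hnet⟩ := exists_net (ρ := Fin r) r (Fintype.card_fin r) hr0
  obtain ⟨U, V, hUV, hVU, G, hG, hgood⟩ :=
    exists_good_signs A hA lam h0 h1 hα hquad hr x hx S Sᶜ hS hT N hNcard hN4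
  set c₁ := 34 * r * (128 * α * r + 8 * ∑ a, lam a) with hc₁
  have hc0 : 0 ≤ c₁ := by positivity
  have hext : ∀ P Q : Matrix (Fin r) ι ℝ,
      (∀ u ∈ N, ∑ i, (Q *ᵥ (A i *ᵥ (u ᵥ* P))) ⬝ᵥ (Q *ᵥ (A i *ᵥ (u ᵥ* P))) ≤ c₁) →
      ∀ v : Fin r → ℝ, ∑ i, (Q *ᵥ (A i *ᵥ (v ᵥ* P))) ⬝ᵥ (Q *ᵥ (A i *ᵥ (v ᵥ* P))) ≤
        4 * c₁ * (v ⬝ᵥ v) := by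
    intro P Q h v
    have key : ∀ u i, (Q * A i * Pᵀ) *ᵥ u = Q *ᵥ (A i *ᵥ (u ᵥ* P)) := fun u i => by
      rw [← Matrix.mulVec_mulVec, ← Matrix.mulVec_mulVec, Matrix.mulVec_transpose]
    have := sum_mulVec_le_of_net (fun i => Q * A i * Pᵀ) N hc0
      (by simpa only [key] using h) hnet v
    simpa only [key] using this
  refine ⟨fun i => sketchMatrix S U V (A i), fun i => sketchMatrix_isSymm _ _ _ _, fun v => ?_,
    G, hG, fun g hg => ?_⟩
  · refine (sum_sketchMatrix_mulVec_le S U V A hA (hext V U hVU) (hext U V hUV) v).trans ?_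
    refine mul_le_mul_of_nonneg_right ?_ (dotProduct_self_nonneg' v)
    -- The coefficient of α is 2 · 4 · 34 · 128 = 34816, and that of the trace term is smaller.
    rw [div_le_iff₀ (by positivity), hc₁]
    have : 34816 * (α + (∑ a, lam a) / r) * (r : ℝ) ^ 2 =
        34816 * (α * r ^ 2 + (∑ a, lam a) * r) := by field_simp
    rw [this]
    nlinarith [mul_nonneg ht0 hrr.le]
  · obtain ⟨ha, hb, herr⟩ := hgood g hg
    have hS0 : 0 < S.card := by omega
    have hT0 : 0 < Sᶜ.card := by omega
    have hcards : (S.card : ℝ) + Sᶜ.card = r := by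
      have := Finset.card_add_card_compl S
      rw [Fintype.card_fin] at this
      exact_mod_cast this
    obtain ⟨hp, hc1, hc2⟩ := sketch_parameters (p := S.card) (q := Sᶜ.card) (ρ := r)
      (by exact_mod_cast hS) (by exact_mod_cast hT) hcards hrr ha hb
    rw [← sketchPoint_dotProduct_self S hS0 hT0 U V (x g)] at hp hc1 hc2
    set y₀ := sketchPoint S U V (x g) with hy₀
    set m := y₀ ⬝ᵥ y₀ with hm
    set c := 2 * (S.card : ℝ) * Sᶜ.card / r / m with hc
    have hsq : (Real.sqrt m)⁻¹ * (Real.sqrt m)⁻¹ = m⁻¹ := by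
      rw [← mul_inv, Real.mul_self_sqrt hp.le]
    refine ⟨(Real.sqrt m)⁻¹ • y₀, ?_, c, hc1, ?_⟩
    · rw [smul_dotProduct, dotProduct_smul, smul_eq_mul, smul_eq_mul, ← mul_assoc, hsq, ← hm,
        inv_mul_cancel₀ hp.ne']
    · refine le_trans (Finset.sum_le_sum fun i _ => ?_) herr
      rw [Matrix.mulVec_smul, smul_dotProduct, dotProduct_smul, smul_eq_mul, smul_eq_mul,
        ← mul_assoc, hsq, sketchPoint_dotProduct_sketchMatrix S hS0 hT0 U V (hA i) (x g)]
      set s := sketchForm U S (x g) (A i *ᵥ sketchVec V Sᶜ (x g))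
      have : m⁻¹ * (2 * S.card * Sᶜ.card / r * s) - c * (x g ⬝ᵥ (A i *ᵥ x g)) =
          c * (s - x g ⬝ᵥ (A i *ᵥ x g)) := by rw [hc]; field_simp
      rw [this, mul_pow]
      exact mul_le_of_le_one_left (sq_nonneg _) (pow_le_one₀ (by linarith) hc2)

end Core

/-! ### Reduction to diagonal ∑ A_i² and the spectral norm -/

section General

open scoped Matrix

lemma exists_orthogonal_diagonal {κ : Type*} [Fintype κ] [DecidableEq κ] (M : Matrix κ κ ℝ)
    (hM : M.IsSymm) : ∃ (U : Matrix κ κ ℝ) (lam : κ → ℝ),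
      Uᵀ * U = 1 ∧ U * Uᵀ = 1 ∧ Uᵀ * M * U = Matrix.diagonal lam := by
  have hH : M.IsHermitian := by
    rw [Matrix.IsHermitian, Matrix.conjTranspose_eq_transpose_of_trivial]
    exact hM
  have hst : star (hH.eigenvectorUnitary : Matrix κ κ ℝ) =
      (hH.eigenvectorUnitary : Matrix κ κ ℝ)ᵀ := by
    rw [Matrix.star_eq_conjTranspose, Matrix.conjTranspose_eq_transpose_of_trivial]
  refine ⟨hH.eigenvectorUnitary, hH.eigenvalues, ?_, ?_, ?_⟩
  · rw [← hst]
    exact Unitary.coe_star_mul_self _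
  · rw [← hst]
    exact Unitary.coe_mul_star_self _
  · rw [← hst]
    have := hH.conjStarAlgAut_star_eigenvectorUnitary
    rw [Unitary.conjStarAlgAut_star_apply] at this
    exact this

variable {ι : Type*} [Fintype ι] {n r : ℕ}

lemma mulVec_dotProduct_mulVec_self {κ : Type*} [Fintype κ] (W : Matrix κ ι ℝ) (v : ι → ℝ) :
    (W *ᵥ v) ⬝ᵥ (W *ᵥ v) = v ⬝ᵥ ((Wᵀ * W) *ᵥ v) := by
  rw [← Matrix.mulVec_mulVec, Matrix.dotProduct_mulVec v, Matrix.vecMul_transpose]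

lemma norm_toLp_sq {κ : Type*} [Fintype κ] (v : κ → ℝ) :
    ‖(WithLp.toLp 2 v : EuclideanSpace ℝ κ)‖ ^ 2 = v ⬝ᵥ v := by
  rw [EuclideanSpace.norm_sq_eq, dotProduct]
  refine Finset.sum_congr rfl fun j _ => ?_
  rw [Real.norm_eq_abs, sq_abs, pow_two]

lemma stack_mulVec_dotProduct_self (A : Fin n → Matrix ι ι ℝ) (v : ι → ℝ) :
    ((Matrix.of fun p j => A p.1 p.2 j : Matrix (Fin n × ι) ι ℝ) *ᵥ v) ⬝ᵥ
      ((Matrix.of fun p j => A p.1 p.2 j : Matrix (Fin n × ι) ι ℝ) *ᵥ v) =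
      ∑ i, (A i *ᵥ v) ⬝ᵥ (A i *ᵥ v) := by
  rw [dotProduct, Fintype.sum_prod_type]
  rfl

variable [DecidableEq ι]

/-- Conjugate by an orthogonal matrix diagonalising ∑ A_i²: the trace, the operator bound and the
values xᵀA_i x are all unchanged. -/
lemma exists_sketch (A : Fin n → Matrix ι ι ℝ) (hA : ∀ i, (A i).IsSymm) {α : ℝ} (hα : 0 < α)
    (hop : ∀ z, ∑ i, (A i *ᵥ z) ⬝ᵥ (A i *ᵥ z) ≤ α * (z ⬝ᵥ z))
    (hr : 2304 ≤ r) {γ : Type*} [Fintype γ] [Nonempty γ] (x : γ → ι → ℝ)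
    (hx : ∀ g, x g ⬝ᵥ x g = 1) :
    ∃ B : Fin n → Matrix (Fin r) (Fin r) ℝ, (∀ i, (B i).IsSymm) ∧
      (∀ v, ∑ i, (B i *ᵥ v) ⬝ᵥ (B i *ᵥ v) ≤
        34816 * (α + (∑ i, A i * A i).trace / r) * (v ⬝ᵥ v)) ∧
      ∃ G : Finset γ, (3 / 4 : ℝ) * Fintype.card γ ≤ (G.card : ℝ) ∧ ∀ g ∈ G,
        ∃ y : Fin r → ℝ, y ⬝ᵥ y = 1 ∧ ∃ c : ℝ, 1 / 9 ≤ c ∧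
          ∑ i, (y ⬝ᵥ (B i *ᵥ y) - c * (x g ⬝ᵥ (A i *ᵥ x g))) ^ 2 ≤
            20736 * ((α + (∑ i, A i * A i).trace / r) / r) := by
  have hsum : (∑ i, A i * A i).IsSymm := by
    rw [Matrix.IsSymm, Matrix.transpose_sum]
    refine Finset.sum_congr rfl fun i _ => ?_
    rw [Matrix.transpose_mul, (hA i).eq]
  obtain ⟨U, lam, hU1, hU2, hD⟩ := exists_orthogonal_diagonal (∑ i, A i * A i) hsum
  have hUv : ∀ v, (U *ᵥ v) ⬝ᵥ (U *ᵥ v) = v ⬝ᵥ v := fun v => by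
    rw [mulVec_dotProduct_mulVec_self, hU1, Matrix.one_mulVec]
  have hUtv : ∀ v, (Uᵀ *ᵥ v) ⬝ᵥ (Uᵀ *ᵥ v) = v ⬝ᵥ v := fun v => by
    rw [mulVec_dotProduct_mulVec_self, Matrix.transpose_transpose, hU2, Matrix.one_mulVec]
  have hmv : ∀ i z, (Uᵀ * A i * U) *ᵥ z = Uᵀ *ᵥ (A i *ᵥ (U *ᵥ z)) := fun i z => by
    simp only [Matrix.mulVec_mulVec, Matrix.mul_assoc]
  have hred : ∀ z, ∑ i, ((Uᵀ * A i * U) *ᵥ z) ⬝ᵥ ((Uᵀ * A i * U) *ᵥ z) =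
      ∑ i, (A i *ᵥ (U *ᵥ z)) ⬝ᵥ (A i *ᵥ (U *ᵥ z)) := fun z =>
    Finset.sum_congr rfl fun i _ => by rw [hmv, hUtv]
  have hquad : ∀ z, ∑ i, ((Uᵀ * A i * U) *ᵥ z) ⬝ᵥ ((Uᵀ * A i * U) *ᵥ z) =
      ∑ a, lam a * z a ^ 2 := by
    intro z
    have : ∑ i, (A i *ᵥ (U *ᵥ z)) ⬝ᵥ (A i *ᵥ (U *ᵥ z)) =
        (U *ᵥ z) ⬝ᵥ ((∑ i, A i * A i) *ᵥ (U *ᵥ z)) := by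
      rw [Matrix.sum_mulVec, dotProduct_sum]
      refine Finset.sum_congr rfl fun i _ => ?_
      rw [mulVec_dotProduct_mulVec_self, (hA i).eq]
    rw [hred, this, ← Matrix.vecMul_transpose, ← Matrix.dotProduct_mulVec, Matrix.mulVec_mulVec,
      Matrix.vecMul_transpose, Matrix.mulVec_mulVec, hD, dotProduct]
    refine Finset.sum_congr rfl fun a _ => ?_
    rw [Matrix.mulVec_diagonal]
    ring
  have hlam : ∀ a, lam a = ∑ i, (A i *ᵥ (U *ᵥ Pi.single a 1)) ⬝ᵥ
      (A i *ᵥ (U *ᵥ Pi.single a 1)) := fun a => by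
    rw [← hred, hquad, Fintype.sum_eq_single a]
    · simp
    · intro b hb
      simp [hb]
  have h0 : ∀ a, 0 ≤ lam a := fun a => by
    rw [hlam]
    exact Finset.sum_nonneg fun i _ => dotProduct_self_nonneg' _
  have h1 : ∀ a, lam a ≤ α := fun a => by
    rw [hlam]
    refine (hop _).trans_eq ?_
    rw [hUv, single_dotProduct, Pi.single_eq_same, one_mul, mul_one]
  have htr : ∑ a, lam a = (∑ i, A i * A i).trace := by
    rw [← Matrix.trace_diagonal, ← hD, Matrix.trace_mul_cycle, hU2, one_mul]
  have hA' : ∀ i, (Uᵀ * A i * U).IsSymm := fun i => by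
    rw [Matrix.IsSymm, Matrix.transpose_mul, Matrix.transpose_mul, Matrix.transpose_transpose,
      (hA i).eq, Matrix.mul_assoc]
  have hx' : ∀ g, (Uᵀ *ᵥ x g) ⬝ᵥ (Uᵀ *ᵥ x g) = 1 := fun g => by rw [hUtv, hx]
  have key : ∀ g i, (Uᵀ *ᵥ x g) ⬝ᵥ ((Uᵀ * A i * U) *ᵥ (Uᵀ *ᵥ x g)) =
      x g ⬝ᵥ (A i *ᵥ x g) := fun g i => by
    rw [hmv, Matrix.mulVec_mulVec _ U, hU2, Matrix.one_mulVec, Matrix.dotProduct_mulVec,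
      Matrix.vecMul_transpose, Matrix.mulVec_mulVec, hU2, Matrix.one_mulVec]
  have := exists_sketch_of_diagonal (fun i => Uᵀ * A i * U) hA' lam h0 h1 hα hquad hr
    (fun g => Uᵀ *ᵥ x g) hx'
  simpa only [key, htr] using this

/-- For symmetric A_i, ∑ A_i² is MᵀM with M the vertical stack, so this is the C⋆-identity. -/
lemma norm_sum_sq_eq_stack (A : Fin n → Matrix ι ι ℝ) (hA : ∀ i, (A i).IsSymm) :
    ‖∑ i, A i ^ 2‖ = ‖(Matrix.of fun p j => A p.1 p.2 j : Matrix (Fin n × ι) ι ℝ)‖ ^ 2 := by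
  rw [pow_two, ← Matrix.l2_opNorm_conjTranspose_mul_self]
  congr 1
  ext a b
  rw [Matrix.sum_apply, Matrix.mul_apply, Fintype.sum_prod_type]
  refine Finset.sum_congr rfl fun i _ => ?_
  rw [pow_two, Matrix.mul_apply]
  refine Finset.sum_congr rfl fun j _ => ?_
  simp [(hA i).apply]

lemma sum_mulVec_le_norm (A : Fin n → Matrix ι ι ℝ) (hA : ∀ i, (A i).IsSymm) (v : ι → ℝ) :
    ∑ i, (A i *ᵥ v) ⬝ᵥ (A i *ᵥ v) ≤ ‖∑ i, A i ^ 2‖ * (v ⬝ᵥ v) := by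
  rw [norm_sum_sq_eq_stack A hA, ← stack_mulVec_dotProduct_self, ← norm_toLp_sq,
    ← norm_toLp_sq v, ← mul_pow]
  gcongr
  exact Matrix.l2_opNorm_mulVec _ (WithLp.toLp 2 v)

lemma norm_sum_sq_le (A : Fin n → Matrix ι ι ℝ) (hA : ∀ i, (A i).IsSymm) {c : ℝ} (hc : 0 ≤ c)
    (h : ∀ v, ∑ i, (A i *ᵥ v) ⬝ᵥ (A i *ᵥ v) ≤ c * (v ⬝ᵥ v)) : ‖∑ i, A i ^ 2‖ ≤ c := by
  rw [norm_sum_sq_eq_stack A hA, ← Real.le_sqrt (norm_nonneg _) hc, Matrix.l2_opNorm_def]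
  refine ContinuousLinearMap.opNorm_le_bound _ (Real.sqrt_nonneg _) fun v => ?_
  refine (sq_le_sq₀ (norm_nonneg _) (by positivity)).1 ?_
  rw [mul_pow, Real.sq_sqrt hc]
  have h1 := norm_toLp_sq
    ((Matrix.of fun p j => A p.1 p.2 j : Matrix (Fin n × ι) ι ℝ) *ᵥ v.ofLp)
  rw [stack_mulVec_dotProduct_self] at h1
  have h2 := norm_toLp_sq v.ofLp
  refine Eq.trans_le ?_ ((h v.ofLp).trans_eq ?_)
  · exact h1
  · rw [← h2]

end General

/-! ### Purification with few columns -/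

section Purify

open scoped Matrix

/-- Dimension count: symmetric k × k matrices are functions on unordered pairs, a space of dimension
(k + 1).choose 2. -/
lemma exists_symm_annihilating {κ : Type*} [Fintype κ] {k : ℕ}
    (G : κ → Matrix (Fin k) (Fin k) ℝ) (hκ : Fintype.card κ < (k + 1).choose 2) :
    ∃ D : Matrix (Fin k) (Fin k) ℝ, D.IsSymm ∧ D ≠ 0 ∧ ∀ q, (D * G q).trace = 0 := by
  let φ : (Sym2 (Fin k) → ℝ) →ₗ[ℝ] (κ → ℝ) :=
    { toFun := fun f q => ∑ a, ∑ b, f s(a, b) * G q b a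
      map_add' := fun f g => by
        ext q
        simp only [Pi.add_apply, add_mul, Finset.sum_add_distrib]
      map_smul' := fun c f => by
        ext q
        simp only [Pi.smul_apply, smul_eq_mul, RingHom.id_apply, Finset.mul_sum, mul_assoc] }
  have hker : LinearMap.ker φ ≠ ⊥ := by
    apply LinearMap.ker_ne_bot_of_finrank_lt
    rw [Module.finrank_fintype_fun_eq_card, Module.finrank_fintype_fun_eq_card, Sym2.card,
      Fintype.card_fin]
    exact hκ
  obtain ⟨f, hf, hf0⟩ := Submodule.exists_mem_ne_zero_of_ne_bot hker
  refine ⟨Matrix.of fun a b => f s(a, b), ?_, ?_, fun q => ?_⟩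
  · ext a b
    simp [Sym2.eq_swap]
  · intro h
    apply hf0
    ext s
    induction s using Sym2.ind with
    | _ a b => exact congrFun (congrFun h a) b
  · exact congrFun hf q

lemma trace_conj_eq_sum {d k : ℕ} (X : Matrix (Fin d) (Fin k) ℝ) (Q : Matrix (Fin d) (Fin d) ℝ) :
    (Xᵀ * Q * X).trace = ∑ j, (fun a => X a j) ⬝ᵥ (Q *ᵥ fun a => X a j) := by
  rw [Matrix.trace]
  refine Finset.sum_congr rfl fun j _ => ?_
  rw [Matrix.diag_apply, Matrix.mul_assoc, Matrix.mul_apply]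
  rfl

/-- Replacing XXᵀ by X(1 - D/μ)Xᵀ changes none of the traces, since D annihilates every XᵀQX. With μ
the eigenvalue of D largest in modulus, 1 - D/μ is positive semidefinite and singular: in the
eigenbasis the columns are rescaled by square roots and one vanishes. -/
lemma exists_fewer_columns {κ : Type*} [Fintype κ] {d k : ℕ}
    (Q : κ → Matrix (Fin d) (Fin d) ℝ) (hκ : Fintype.card κ < (k + 2).choose 2)
    (X : Matrix (Fin d) (Fin (k + 1)) ℝ) :
    ∃ X' : Matrix (Fin d) (Fin k) ℝ, ∀ q, (X'ᵀ * Q q * X').trace = (Xᵀ * Q q * X).trace := by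
  obtain ⟨D, hD, hD0, hDG⟩ := exists_symm_annihilating (fun q => Xᵀ * Q q * X) hκ
  obtain ⟨U, μ, hU1, hU2, hdiag⟩ := exists_orthogonal_diagonal D hD
  obtain ⟨j₀, -, hj₀⟩ := Finset.exists_max_image Finset.univ (fun j => |μ j|)
    Finset.univ_nonempty
  have hD' : D = U * Matrix.diagonal μ * Uᵀ := by
    rw [← hdiag]
    calc D = (U * Uᵀ) * D * (U * Uᵀ) := by rw [hU2, one_mul, mul_one]
      _ = _ := by simp only [Matrix.mul_assoc]
  have hμ : μ j₀ ≠ 0 := by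
    intro h
    apply hD0
    have : μ = 0 := by
      ext j
      have := hj₀ j (Finset.mem_univ j)
      rw [h, abs_zero] at this
      exact abs_eq_zero.1 (le_antisymm this (abs_nonneg _))
    rw [hD', this]
    simp
  have hw : ∀ j, 0 ≤ 1 - μ j / μ j₀ := fun j => by
    have h1 : |μ j / μ j₀| ≤ 1 := by
      rw [abs_div, div_le_one (abs_pos.2 hμ)]
      exact hj₀ j (Finset.mem_univ j)
    linarith [le_abs_self (μ j / μ j₀)]
  set Y := X * U with hY
  refine ⟨Matrix.of fun a j => Real.sqrt (1 - μ (j₀.succAbove j) / μ j₀) * Y a (j₀.succAbove j),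
    fun q => ?_⟩
  have htr : (Xᵀ * Q q * X).trace = ∑ j, (fun a => Y a j) ⬝ᵥ (Q q *ᵥ fun a => Y a j) := by
    rw [← trace_conj_eq_sum, hY, Matrix.transpose_mul]
    calc (Xᵀ * Q q * X).trace = ((U * Uᵀ) * (Xᵀ * Q q * X)).trace := by rw [hU2, one_mul]
      _ = (Uᵀ * (Xᵀ * Q q * X) * U).trace := by rw [Matrix.mul_assoc, Matrix.trace_mul_comm]
      _ = _ := by simp only [Matrix.mul_assoc]
  have hzero : ∑ j, μ j * ((fun a => Y a j) ⬝ᵥ (Q q *ᵥ fun a => Y a j)) = 0 := by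
    have h1 : (D * (Xᵀ * Q q * X)).trace = (Matrix.diagonal μ * (Yᵀ * Q q * Y)).trace := by
      rw [hD', hY, Matrix.transpose_mul, Matrix.mul_assoc, Matrix.mul_assoc,
        Matrix.trace_mul_comm]
      simp only [Matrix.mul_assoc]
    rw [← hDG q, h1, Matrix.trace]
    refine Finset.sum_congr rfl fun j _ => ?_
    rw [Matrix.diag_apply, Matrix.diagonal_mul, Matrix.mul_assoc, Matrix.mul_apply]
    rfl
  rw [trace_conj_eq_sum, htr]
  have hterm : ∀ j : Fin k, (fun a => (Matrix.of fun a j =>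
        Real.sqrt (1 - μ (j₀.succAbove j) / μ j₀) * Y a (j₀.succAbove j) :
          Matrix (Fin d) (Fin k) ℝ) a j) =
      Real.sqrt (1 - μ (j₀.succAbove j) / μ j₀) • fun a => Y a (j₀.succAbove j) := fun j => rfl
  simp only [hterm, Matrix.mulVec_smul, smul_dotProduct, dotProduct_smul, smul_eq_mul]
  simp only [← mul_assoc, Real.mul_self_sqrt (hw _)]
  have hall : ∑ j, (1 - μ j / μ j₀) * ((fun a => Y a j) ⬝ᵥ (Q q *ᵥ fun a => Y a j)) =
      ∑ j, (fun a => Y a j) ⬝ᵥ (Q q *ᵥ fun a => Y a j) := by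
    have : ∀ j, (1 - μ j / μ j₀) * ((fun a => Y a j) ⬝ᵥ (Q q *ᵥ fun a => Y a j)) =
        (fun a => Y a j) ⬝ᵥ (Q q *ᵥ fun a => Y a j) -
          (μ j₀)⁻¹ * (μ j * ((fun a => Y a j) ⬝ᵥ (Q q *ᵥ fun a => Y a j))) := fun j => by
      ring
    simp only [this, Finset.sum_sub_distrib, ← Finset.mul_sum, hzero]
    ring
  rw [← hall, Fin.sum_univ_succAbove _ j₀, div_self hμ]
  ring

lemma exists_min_columns {κ : Type*} [Fintype κ] {d k₀ : ℕ}
    (Q : κ → Matrix (Fin d) (Fin d) ℝ) (hκ : Fintype.card κ < (k₀ + 2).choose 2)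
    {k : ℕ} (hk : k₀ ≤ k) : ∀ X : Matrix (Fin d) (Fin k) ℝ,
    ∃ X' : Matrix (Fin d) (Fin k₀) ℝ, ∀ q, (X'ᵀ * Q q * X').trace = (Xᵀ * Q q * X).trace := by
  induction k, hk using Nat.le_induction with
  | base => exact fun X => ⟨X, fun _ => rfl⟩
  | succ k hk ih =>
    intro X
    obtain ⟨X', hX'⟩ := exists_fewer_columns Q
      (hκ.trans_le (Nat.choose_le_choose 2 (by omega))) X
    obtain ⟨X'', hX''⟩ := ih X'
    exact ⟨X'', fun q => (hX'' q).trans (hX' q)⟩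

/-- The count n + 1 is one constraint per A_i plus the trace normalisation. -/
lemma succ_lt_choose_sqrt {n : ℕ} (hn : 0 < n) : n + 1 < (Nat.sqrt (4 * n) + 2).choose 2 := by
  have h := Nat.lt_succ_sqrt (4 * n)
  set s := Nat.sqrt (4 * n)
  have h2 : (s + 2) * (s + 1) = 2 * (s + 2).choose 2 := by
    rw [Nat.choose_two_right, Nat.mul_div_cancel']
    · rfl
    · have := Nat.even_mul_succ_self (s + 1)
      rw [mul_comm]
      exact this.two_dvd
  simp only [Nat.succ_eq_add_one] at h
  nlinarith

/-- The number of columns of a purification: the minimum of `d` and `⌊2√n⌋`. -/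
def purificationRank (n d : ℕ) : ℕ := min d (Nat.sqrt (4 * n))

lemma purificationRank_le (n d : ℕ) :
    (purificationRank n d : ℝ) ≤ 2 * min (Real.sqrt n) (d : ℝ) := by
  have h1 : (Nat.sqrt (4 * n) : ℝ) ≤ 2 * Real.sqrt n := by
    have : (2 : ℝ) * Real.sqrt n = Real.sqrt ((4 * n : ℕ) : ℝ) := by
      push_cast
      rw [Real.sqrt_mul (by norm_num), show (4 : ℝ) = 2 ^ 2 by norm_num,
        Real.sqrt_sq (by norm_num)]
    rw [this]
    exact Real.nat_sqrt_le_real_sqrt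
  rw [purificationRank, mul_min_of_nonneg _ _ (by norm_num)]
  push_cast
  refine le_min ((min_le_right _ _).trans h1) ((min_le_left _ _).trans ?_)
  have : (0 : ℝ) ≤ d := by positivity
  linarith

open scoped MatrixOrder in
lemma exists_purification {n d : ℕ} (hn : 0 < n) (A : Fin n → Matrix (Fin d) (Fin d) ℝ)
    {Y : Matrix (Fin d) (Fin d) ℝ} (hY : IsDensityMatrix Y) :
    ∃ X : Matrix (Fin d) (Fin (purificationRank n d)) ℝ, (Xᵀ * X).trace = 1 ∧
      ∀ i, (Xᵀ * A i * X).trace = matInner Y (A i) := by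
  obtain ⟨W, hW⟩ : ∃ W : Matrix (Fin d) (Fin d) ℝ, Y = W * Wᵀ := by
    obtain ⟨B, hB⟩ := CStarAlgebra.nonneg_iff_eq_star_mul_self.1 hY.1.nonneg
    refine ⟨Bᵀ, ?_⟩
    rw [hB, Matrix.star_eq_conjTranspose, Matrix.conjTranspose_eq_transpose_of_trivial,
      Matrix.transpose_transpose]
  have h1 : (Wᵀ * 1 * W).trace = 1 := by
    rw [Matrix.mul_one, Matrix.trace_mul_comm, ← hW, hY.2]
  have h2 : ∀ i, (Wᵀ * A i * W).trace = matInner Y (A i) := fun i => by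
    rw [matInner, hW, Matrix.trace_mul_cycle]
  -- The index `none` carries the identity, so the trace of Y is preserved along with the ⟨Y, A_i⟩.
  let Q : Option (Fin n) → Matrix (Fin d) (Fin d) ℝ := fun q => q.elim 1 A
  suffices h : ∃ X : Matrix (Fin d) (Fin (purificationRank n d)) ℝ,
      ∀ q, (Xᵀ * Q q * X).trace = (Wᵀ * Q q * W).trace by
    obtain ⟨X, hX⟩ := h
    refine ⟨X, ?_, fun i => (hX (some i)).trans (h2 i)⟩
    have := (hX none).trans h1
    rwa [show Q none = 1 from rfl, Matrix.mul_one] at this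
  rcases le_total d (Nat.sqrt (4 * n)) with h | h
  · rw [purificationRank, min_eq_left h]
    exact ⟨W, fun _ => rfl⟩
  · rw [purificationRank, min_eq_right h]
    exact exists_min_columns Q (by simpa using succ_lt_choose_sqrt hn) h W

end Purify

/-! ### Vectorisation and assembly -/

section Main

open scoped Matrix Kronecker

/-- Chebyshev counting: at most δn of the squares can exceed E / (δn). -/
lemma exists_finset_abs_le_sqrt {n : ℕ} (hn : 0 < n) (w : Fin n → ℝ) {E δ : ℝ} (hδ : 0 < δ)
    (h : ∑ i, w i ^ 2 ≤ E) :
    ∃ I : Finset (Fin n), (1 - δ) * (n : ℝ) ≤ (I.card : ℝ) ∧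
      ∀ i ∈ I, |w i| ≤ Real.sqrt (E / (δ * n)) := by
  have hn' : (0 : ℝ) < n := by exact_mod_cast hn
  have hE : 0 ≤ E := (Finset.sum_nonneg fun _ _ => sq_nonneg _).trans h
  refine ⟨Finset.univ.filter fun i => w i ^ 2 ≤ E / (δ * n), ?_, fun i hi =>
    Real.abs_le_sqrt (Finset.mem_filter.1 hi).2⟩
  have hsplit : ((Finset.univ.filter fun i => w i ^ 2 ≤ E / (δ * n)).card : ℝ) +
      ((Finset.univ.filter fun i => ¬ w i ^ 2 ≤ E / (δ * n)).card : ℝ) = n := by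
    have := Finset.card_filter_add_card_filter_not (s := (Finset.univ : Finset (Fin n)))
      (fun i => w i ^ 2 ≤ E / (δ * n))
    rw [Finset.card_univ, Fintype.card_fin] at this
    exact_mod_cast this
  suffices ((Finset.univ.filter fun i => ¬ w i ^ 2 ≤ E / (δ * n)).card : ℝ) ≤ δ * n by linarith
  -- For E = 0 the count cannot be divided by E, but then every w i vanishes.
  rcases hE.eq_or_lt with h0 | h0
  · have hz : ∀ i, w i ^ 2 ≤ E / (δ * n) := fun i => by
      rw [← h0, zero_div, h0]
      exact (Finset.single_le_sum (f := fun i => w i ^ 2) (fun _ _ => sq_nonneg _)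
        (Finset.mem_univ i)).trans h
    rw [Finset.filter_false_of_mem fun i _ => not_not.2 (hz i)]
    simp only [Finset.card_empty, Nat.cast_zero]
    positivity
  · have h1 : ((Finset.univ.filter fun i => ¬ w i ^ 2 ≤ E / (δ * n)).card : ℝ) * (E / (δ * n)) ≤
        E := by
      rw [← nsmul_eq_mul]
      refine (Finset.card_nsmul_le_sum _ (fun i => w i ^ 2) _ fun i hi =>
        (not_le.1 (Finset.mem_filter.1 hi).2).le).trans ?_
      exact (Finset.sum_le_sum_of_subset_of_nonneg (Finset.filter_subset _ _)
        fun _ _ _ => sq_nonneg _).trans h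
    rw [mul_div_assoc', div_le_iff₀ (by positivity), mul_comm E] at h1
    exact le_of_mul_le_mul_right h1 h0

section Ampliation

variable {n d k : ℕ}

lemma kronecker_one_mulVec (A : Matrix (Fin d) (Fin d) ℝ) (z : Fin d × Fin k → ℝ) (a : Fin d)
    (l : Fin k) : ((A ⊗ₖ (1 : Matrix (Fin k) (Fin k) ℝ)) *ᵥ z) (a, l) =
      (A *ᵥ fun b => z (b, l)) a := by
  simp only [Matrix.mulVec, dotProduct, Matrix.kroneckerMap_apply, Fintype.sum_prod_type]
  refine Finset.sum_congr rfl fun b _ => ?_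
  rw [Fintype.sum_eq_single l]
  · simp
  · intro l' hl'
    simp [Matrix.one_apply_ne hl'.symm]

lemma kronecker_one_isSymm {A : Matrix (Fin d) (Fin d) ℝ} (hA : A.IsSymm) :
    (A ⊗ₖ (1 : Matrix (Fin k) (Fin k) ℝ)).IsSymm := by
  rw [Matrix.IsSymm, ← Matrix.kroneckerMap_transpose, hA.eq, Matrix.transpose_one]

lemma sum_kronecker_one_mulVec_le (A : Fin n → Matrix (Fin d) (Fin d) ℝ)
    (hA : ∀ i, (A i).IsSymm) (z : Fin d × Fin k → ℝ) :
    ∑ i, ((A i ⊗ₖ (1 : Matrix (Fin k) (Fin k) ℝ)) *ᵥ z) ⬝ᵥ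
      ((A i ⊗ₖ (1 : Matrix (Fin k) (Fin k) ℝ)) *ᵥ z) ≤ ‖∑ i, A i ^ 2‖ * (z ⬝ᵥ z) := by
  have h1 : ∀ w : Fin d × Fin k → ℝ, w ⬝ᵥ w = ∑ l, (fun a => w (a, l)) ⬝ᵥ fun a => w (a, l) :=
    fun w => by rw [dotProduct, Fintype.sum_prod_type_right]; rfl
  simp only [h1, kronecker_one_mulVec]
  rw [Finset.sum_comm, Finset.mul_sum]
  exact Finset.sum_le_sum fun l _ => sum_mulVec_le_norm A hA _

lemma trace_sum_kronecker_one (A : Fin n → Matrix (Fin d) (Fin d) ℝ) :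
    (∑ i, (A i ⊗ₖ (1 : Matrix (Fin k) (Fin k) ℝ)) * (A i ⊗ₖ (1 : Matrix (Fin k) (Fin k) ℝ))).trace =
      k * (∑ i, A i ^ 2).trace := by
  rw [Matrix.trace_sum, Matrix.trace_sum, Finset.mul_sum]
  refine Finset.sum_congr rfl fun i _ => ?_
  rw [← Matrix.mul_kronecker_mul, Matrix.trace_kronecker, one_mul, Matrix.trace_one,
    Fintype.card_fin, pow_two, mul_comm]

/-- A ⊗ 1 acts on each column of X separately, so the trace is a quadratic form in the vectorised X.
-/
lemma trace_transpose_mul_mul (X : Matrix (Fin d) (Fin k) ℝ) (A : Matrix (Fin d) (Fin d) ℝ) :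
    (Xᵀ * A * X).trace = (fun p : Fin d × Fin k => X p.1 p.2) ⬝ᵥ
      ((A ⊗ₖ (1 : Matrix (Fin k) (Fin k) ℝ)) *ᵥ fun p => X p.1 p.2) := by
  rw [trace_conj_eq_sum, dotProduct, Fintype.sum_prod_type_right]
  simp only [kronecker_one_mulVec]
  rfl

end Ampliation

lemma exists_unit_vector {n d : ℕ} (hn : 0 < n) (A : Fin n → Matrix (Fin d) (Fin d) ℝ)
    {Y : Matrix (Fin d) (Fin d) ℝ} (hY : IsDensityMatrix Y) :
    ∃ x : Fin d × Fin (purificationRank n d) → ℝ, x ⬝ᵥ x = 1 ∧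
      ∀ i, x ⬝ᵥ ((A i ⊗ₖ (1 : Matrix (Fin (purificationRank n d)) (Fin (purificationRank n d)) ℝ))
        *ᵥ x) = matInner Y (A i) := by
  obtain ⟨X, hX1, hXA⟩ := exists_purification hn A hY
  refine ⟨fun p => X p.1 p.2, ?_, fun i => by rw [← trace_transpose_mul_mul, hXA]⟩
  have := trace_transpose_mul_mul X 1
  rw [Matrix.mul_one, hX1, Matrix.one_kronecker_one, Matrix.one_mulVec] at this
  exact this.symm

/-- Cauchy–Schwarz at the purifying unit vector. It makes B = 0 acceptable when r is bounded. -/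
lemma sum_matInner_sq_le {n d : ℕ} (hn : 0 < n) (A : Fin n → Matrix (Fin d) (Fin d) ℝ)
    (hA : ∀ i, (A i).IsSymm) {Y : Matrix (Fin d) (Fin d) ℝ} (hY : IsDensityMatrix Y) :
    ∑ i, matInner Y (A i) ^ 2 ≤ ‖∑ i, A i ^ 2‖ := by
  obtain ⟨x, hx, hxA⟩ := exists_unit_vector hn A hY
  refine le_trans (Finset.sum_le_sum fun i _ => ?_)
    ((sum_kronecker_one_mulVec_le A hA x).trans_eq (by rw [hx, mul_one]))
  rw [← hxA]
  have h := Finset.sum_mul_sq_le_sq_mul_sq Finset.univ x ((A i ⊗ₖ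
    (1 : Matrix (Fin (purificationRank n d)) (Fin (purificationRank n d)) ℝ)) *ᵥ x)
  simp only [pow_two (x _), pow_two (Matrix.mulVec _ _ _)] at h
  change (x ⬝ᵥ _) ^ 2 ≤ (x ⬝ᵥ x) * (_ ⬝ᵥ _) at h
  rwa [hx, one_mul] at h

lemma matInner_rankOne {r : ℕ} (y : Fin r → ℝ) (B : Matrix (Fin r) (Fin r) ℝ) :
    matInner (rankOne (WithLp.toLp 2 y)) B = y ⬝ᵥ (B *ᵥ y) := by
  rw [matInner, Matrix.trace_mul_comm, Matrix.trace]
  simp only [dotProduct, Matrix.mulVec, Finset.mul_sum, Matrix.diag_apply, Matrix.mul_apply]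
  refine Finset.sum_congr rfl fun a _ => Finset.sum_congr rfl fun b _ => ?_
  simp only [rankOne, Matrix.of_apply]
  ring

lemma trace_sum_sq_nonneg {n d : ℕ} (A : Fin n → Matrix (Fin d) (Fin d) ℝ)
    (hA : ∀ i, (A i).IsSymm) : 0 ≤ (∑ i, A i ^ 2).trace := by
  rw [Matrix.trace_sum]
  refine Finset.sum_nonneg fun i _ => Finset.sum_nonneg fun a _ => ?_
  rw [Matrix.diag_apply, pow_two, Matrix.mul_apply]
  refine Finset.sum_nonneg fun b _ => ?_
  rw [(hA i).apply]
  exact mul_self_nonneg _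

lemma sketchError_eq {n d r : ℕ} (hn : 0 < n) (hr : 0 < r) (A : Matrix (Fin d) (Fin d) ℝ) :
    sketchError n r A = sketchBound n r A / (n * r) := by
  have hn' : (n : ℝ) ≠ 0 := by exact_mod_cast hn.ne'
  have hr' : (r : ℝ) ≠ 0 := by exact_mod_cast hr.ne'
  rw [sketchError, sketchBound]
  field_simp

lemma norm_le_sketchBound {n d r : ℕ} {A : Matrix (Fin d) (Fin d) ℝ} (hA : 0 ≤ A.trace) :
    ‖A‖ ≤ sketchBound n r A := by
  have : 0 ≤ min (Real.sqrt n) (d : ℝ) := le_min (Real.sqrt_nonneg _) (Nat.cast_nonneg _)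
  rw [sketchBound]
  have : 0 ≤ min (Real.sqrt n) (d : ℝ) * A.trace / r := by positivity
  linarith

lemma norm_add_purificationRank_le {n d r : ℕ} {A : Matrix (Fin d) (Fin d) ℝ}
    (hA : 0 ≤ A.trace) :
    ‖A‖ + purificationRank n d * A.trace / r ≤ 2 * sketchBound n r A := by
  have h := purificationRank_le n d
  have h2 : purificationRank n d * A.trace / r ≤
      2 * min (Real.sqrt n) (d : ℝ) * A.trace / r := by gcongr
  have h3 : 2 * min (Real.sqrt n) (d : ℝ) * A.trace / r =
      2 * (min (Real.sqrt n) (d : ℝ) * A.trace / r) := by ring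
  rw [sketchBound]
  linarith [norm_nonneg A]

theorem mainTheorem6 (δ : ℝ) (hδ : 0 < δ) :
    -- the constants hidden in `O_δ` and `Ω_δ`, which depend on `δ` only
    ∃ C : ℝ, 0 < C ∧ ∃ c₀ : ℝ, 0 < c₀ ∧
      ∀ (n d : ℕ), 0 < n → 0 < d →
      ∀ (A : Fin n → Matrix (Fin d) (Fin d) ℝ),
        (∀ i, (A i).IsSymm) → (∀ i, (A i).trace = 0) →
      ∀ (Y : (Fin n → ℤˣ) → Matrix (Fin d) (Fin d) ℝ),
        (∀ g, IsDensityMatrix (Y g)) →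
      ∀ (r : ℕ), 0 < r →
        ∃ B : Fin n → Matrix (Fin r) (Fin r) ℝ,
          (∀ i, (B i).IsSymm) ∧
          ‖∑ i, B i ^ 2‖ ≤ C * sketchBound n r (∑ i, A i ^ 2) ∧
          ∃ G : Finset (Fin n → ℤˣ),
            (3 / 4 : ℝ) * 2 ^ n ≤ (G.card : ℝ) ∧
            ∀ g ∈ G, ∃ y : EuclideanSpace ℝ (Fin r), ‖y‖ = 1 ∧
              ∃ c : ℝ, c₀ ≤ c ∧
              ∃ I : Finset (Fin n),
                (1 - δ) * (n : ℝ) ≤ (I.card : ℝ) ∧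
                ∀ i ∈ I,
                  |matInner (rankOne y) (B i) - c * matInner (Y g) (A i)| ≤
                    Real.sqrt (C * sketchError n r (∑ i, A i ^ 2)) := by
  -- 41472 = 2 · 20736 and 69632 = 2 · 34816: the factor 2 comes from k ≤ 2 min(√n, d), and 1/δ from
  -- the Chebyshev count.
  have hC1 : 41472 / δ ≤ 70000 * (1 + 1 / δ) := by
    rw [mul_add, mul_one_div]
    have : 41472 / δ ≤ 70000 / δ := by gcongr; norm_num
    linarith
  have hC2 : (69632 : ℝ) ≤ 70000 * (1 + 1 / δ) := by
    have : 0 < 1 / δ := by positivity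
    linarith
  set C : ℝ := 70000 * (1 + 1 / δ) with hC
  have hC0 : 0 < C := by linarith
  refine ⟨C, hC0, 1 / 9, by norm_num, fun n d hn hd A hA _ Y hY r hr => ?_⟩
  have hn' : (0 : ℝ) < n := by exact_mod_cast hn
  have hr' : (0 : ℝ) < r := by exact_mod_cast hr
  have hτ := trace_sum_sq_nonneg A hA
  have hbound := norm_le_sketchBound (n := n) (r := r) hτ
  have hbound' := norm_add_purificationRank_le (n := n) (r := r) hτ
  set α := ‖∑ i, A i ^ 2‖ with hα
  set σ := sketchBound n r (∑ i, A i ^ 2) with hσ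
  have hα0 : 0 ≤ α := norm_nonneg _
  have hσ0 : 0 ≤ σ := hα0.trans hbound
  have hcardG : (Fintype.card (Fin n → ℤˣ) : ℝ) = 2 ^ n := by simp
  have herr : ∀ E : ℝ, E ≤ 41472 * (σ / r) →
      E / (δ * n) ≤ C * sketchError n r (∑ i, A i ^ 2) := fun E hE => by
    rw [sketchError_eq hn hr, ← hσ]
    calc E / (δ * n) ≤ 41472 * (σ / r) / (δ * n) := by gcongr
      _ = 41472 / δ * (σ / (n * r)) := by field_simp
      _ ≤ C * (σ / (n * r)) := by gcongr
  -- In the degenerate case take B = 0 and c = 1: the squares ⟨Y_g, A_i⟩² sum to at most α ≤ 41472 σ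
  -- / r. The exponential moments of the main case need α > 0.
  by_cases hcase : r < 2304 ∨ α = 0
  · refine ⟨fun _ => 0, fun _ => Matrix.isSymm_zero, ?_, Finset.univ, ?_, fun g _ => ?_⟩
    · simp only [ne_eq, OfNat.ofNat_ne_zero, not_false_eq_true, zero_pow, Finset.sum_const_zero,
        norm_zero]
      positivity
    · rw [Finset.card_univ, hcardG]
      have : (0 : ℝ) < 2 ^ n := by positivity
      linarith
    · obtain ⟨I, hI, hIb⟩ := exists_finset_abs_le_sqrt hn (fun i => matInner (Y g) (A i)) hδ
        (sum_matInner_sq_le hn A hA (hY g))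
      refine ⟨EuclideanSpace.single ⟨0, hr⟩ 1, by simp, 1, by norm_num, I, hI, fun i hi => ?_⟩
      have hz : matInner (rankOne (EuclideanSpace.single (⟨0, hr⟩ : Fin r) (1 : ℝ)))
          (0 : Matrix (Fin r) (Fin r) ℝ) = 0 := by simp [matInner]
      rw [hz, one_mul, zero_sub, abs_neg]
      refine (hIb i hi).trans (Real.sqrt_le_sqrt (herr _ ?_))
      rw [mul_div_assoc', le_div_iff₀ hr']
      rcases hcase with h | h
      · have h' : (r : ℝ) ≤ 2304 := by exact_mod_cast h.le
        nlinarith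
      · rw [← hα, h, zero_mul]
        positivity
  · rw [not_or, not_lt] at hcase
    have hαpos : 0 < α := lt_of_le_of_ne hα0 (Ne.symm hcase.2)
    choose x hx hxA using fun g => exists_unit_vector hn A (hY g)
    obtain ⟨B, hB, hBn, G, hG, hgood⟩ := exists_sketch
      (fun i => A i ⊗ₖ (1 : Matrix (Fin (purificationRank n d)) (Fin (purificationRank n d)) ℝ))
      (fun i => kronecker_one_isSymm (hA i)) hαpos (sum_kronecker_one_mulVec_le A hA) hcase.1 x hx
    rw [trace_sum_kronecker_one] at hBn hgood
    refine ⟨B, hB, ?_, G, by rwa [hcardG] at hG, fun g hg => ?_⟩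
    · have hnorm : ‖∑ i, B i ^ 2‖ ≤
          34816 * (α + purificationRank n d * (∑ i, A i ^ 2).trace / r) :=
        norm_sum_sq_le B hB (by positivity) hBn
      have := mul_le_mul_of_nonneg_right hC2 hσ0
      linarith
    · obtain ⟨y, hy, c, hc, hsum⟩ := hgood g hg
      obtain ⟨I, hI, hIb⟩ := exists_finset_abs_le_sqrt hn _ hδ hsum
      refine ⟨WithLp.toLp 2 y, ?_, c, hc, I, hI, fun i hi => ?_⟩
      · have := norm_toLp_sq y
        rw [hy] at this
        exact (pow_eq_one_iff_of_nonneg (norm_nonneg _) two_ne_zero).1 this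
      · rw [matInner_rankOne, ← hxA g i]
        refine (hIb i hi).trans (Real.sqrt_le_sqrt (herr _ ?_))
        rw [show 41472 * (σ / r) = 20736 * (2 * σ / r) by ring]
        gcongr

end Main
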